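/- A real polynomial is called a real Morse polynomial if it is monic, all roots of its derivative (critical points) are real and simple, and its critical values are pairwise different. For a real polynomial, enumerate its real critical points $x_1<\dots<x_n$ and its distinct critical values in increasing order; its passport is the sequence $(a_1,\dots,a_n)$, where $a_i$ is the number of the critical value at $x_i$ (equal critical values have equal numbers). A degenerate snake of order 4 is the plot of a monic real polynomial of degree 5 with four real critical points and exactly three critical values; it is recorded by its passport. For $(b,c)\in\mathbb R^2$ put $$q=x^3+3x^2+bx+c,\qquad p=x^5+\tfrac{15}{4}x^4+\tfrac{5b}{3}x^3+\tfrac{5c}{2}x^2,$$ so that $p'=5xq$, and $$dq=54bc-108c-4b^3+9b^2-27c^2,$$ $$g=128b^3-1998b^2-216c^2+1512bc+3645b-729c,$$ $$h=640b^3-1350b^2+5832c^2-9720bc+18225c.$$ Let $\Omega$ be the set of $(b,c)$ for which $q$ has three pairwise different negative roots, and let $O=(0,0)$, $A=(3,1)$, $B=(9/4,0)$, $D=(135/64,0)$, $E=(45/16,25/32)$. A curvilinear triangle $UVW$ is a bounded connected open set whose boundary is the union of three simple arcs $UV$, $VW$, $WU$ that meet only at the common vertices. Then: 1. For every real Morse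 polynomial $P$ of degree 5 there are $(b,c)\in\Omega$ and reals $k>0$, $l$, $m$ with $P(kx+l)=k^5p(x)+m$; here $p$ is a Morse polynomial with the same passport as $P$. 2. $dq$ is the discriminant of $q$, and $\Omega=\{b>0,\ c>0,\ dq>0\}$. The set $\Omega$ is a curvilinear triangle $OAB$, whose side $OB$ is a straight segment and whose sides $OA$ and $AB$ together form the curve $\{dq=0,\ b\ge 0,\ c\ge 0\}$; the point $E$ divides the side $AB$ into arcs $AE$ and $EB$, and the point $D$ lies on $OB$. 3. For $(b,c)\in\Omega$: $g=0$ if and only if $p$ takes equal values at two different roots of $q$; $h=0$ if and only if $p$ vanishes at some root of $q$. For $b,c>0$ the polynomial $p$ is Morse if and only if $(b,c)\in\Omega$, $g\ne0$ and $h\ne0$. 4. The curves $g=0$ and $h=0$ have exactly one common point $F\approx(2.73,\,0.72)$ in $\Omega$ (coordinates up to an error less than $0.005$). There are simple arcs $AF$, $FD$, $OF$, $FE$, $ED$ such that $\{g=0\}\cap\Omega=(AF\cup FD)\setminus\{A,D\}$ and $\{h=0\}\cap\Omega=(OF\cup FE\cup ED)\setminus\{O,E,D\}$. These arcs divide $\Omega$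 into five curvilinear triangles: $\Omega\setminus(\{g=0\}\cup\{h=0\})$ is the disjoint union of curvilinear triangles $OAF$, $AEF$, $ODF$, $DEF$, $BDE$, whose sides are the arcs named above and the segments $OD$, $BD$. 5. For $(b,c)\in\Omega$, the polynomial $p$ is a Morse polynomial with passport $(4,2,3,1)$, $(3,2,4,1)$, $(4,1,3,2)$, $(3,1,4,2)$, $(2,1,4,3)$ if and only if $(b,c)$ lies in $OAF$, $AEF$, $ODF$, $DEF$, $BDE$, respectively. These five passports are exactly the passports of real Morse polynomials of degree 5. 6. For $(b,c)\in\Omega$, the plot of $p$ is a degenerate snake with passport $(3,2,3,1)$, $(3,1,2,1)$, $(3,1,3,2)$, $(2,1,3,1)$, $(2,1,3,2)$ if and only if $(b,c)$ lies on the arc $AF$, $OF$, $FD$, $FE$, $ED$, respectively, endpoints excluded. These five passports are exactly those of the degenerate snakes of order 4. -/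

import Mathlib

open Polynomial

namespace MorseQuintic

noncomputable section

/-- The real critical points of a real polynomial (the real roots of its derivative). -/
def criticalPoints (P : ℝ[X]) : Finset ℝ := P.derivative.roots.toFinset

/-- The values of a polynomial at its real critical points. -/
def criticalValues (P : ℝ[X]) : Finset ℝ := (criticalPoints P).image (fun x => P.eval x)

/-- The number of the critical value `v` when the distinct critical values are enumerated
`1, 2, 3, …` in increasing order. -/
def valueNumber (P : ℝ[X]) (v : ℝ) : ℕ := ((criticalValues P).filter (fun w => w ≤ v)).card

/-- The passport: the critical points are listed in increasing order, and the `i`-th entry is the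
number of the critical value at the `i`-th critical point. For a polynomial with coinciding critical
values, equal values get equal numbers, so that the same list records a degenerate snake. -/
def passport (P : ℝ[X]) : List ℕ :=
  ((criticalPoints P).sort (fun x y => x ≤ y)).map (fun x => valueNumber P (P.eval x))

/-- Real Morse polynomials: monic, all roots of the derivative are real and simple, and the critical
values are pairwise different. -/
def IsMorse (P : ℝ[X]) : Prop :=
  P.Monic ∧ P.derivative.Splits ∧ P.derivative.roots.Nodup ∧
    Set.InjOn (fun x => P.eval x) {x | P.derivative.IsRoot x}

/-- Monic quintics whose plot is a degenerate snake: four real critical points, but only three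
critical values. -/
def IsDegenerateSnake (P : ℝ[X]) : Prop :=
  P.Monic ∧ P.natDegree = 5 ∧ (criticalPoints P).card = 4 ∧ (criticalValues P).card = 3

/-- `q = x³ + 3x² + bx + c`, where `u = (b, c)`. -/
def q (u : ℝ × ℝ) : ℝ[X] := X ^ 3 + C 3 * X ^ 2 + C u.1 * X + C u.2

/-- `p = x⁵ + (15/4)x⁴ + (5b/3)x³ + (5c/2)x²`, where `u = (b, c)`. -/
def p (u : ℝ × ℝ) : ℝ[X] :=
  X ^ 5 + C (15 / 4) * X ^ 4 + C (5 * u.1 / 3) * X ^ 3 + C (5 * u.2 / 2) * X ^ 2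

/-- The polynomial defining the discriminant curve. -/
def dq (u : ℝ × ℝ) : ℝ :=
  54 * u.1 * u.2 - 108 * u.2 - 4 * u.1 ^ 3 + 9 * u.1 ^ 2 - 27 * u.2 ^ 2

/-- The polynomial defining the curve of equal critical values at roots of `q`. -/
def g (u : ℝ × ℝ) : ℝ :=
  128 * u.1 ^ 3 - 1998 * u.1 ^ 2 - 216 * u.2 ^ 2 + 1512 * u.1 * u.2 + 3645 * u.1 - 729 * u.2

/-- The polynomial defining the curve of vanishing critical values at roots of `q`. -/
def h (u : ℝ × ℝ) : ℝ :=
  640 * u.1 ^ 3 - 1350 * u.1 ^ 2 + 5832 * u.2 ^ 2 - 9720 * u.1 * u.2 + 18225 * u.2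

/-- The parameters for which `q` has three pairwise different negative roots. -/
def region : Set (ℝ × ℝ) :=
  {u | ∃ r s t : ℝ, r < s ∧ s < t ∧ t < 0 ∧ q u = (X - C r) * (X - C s) * (X - C t)}

def ptO : ℝ × ℝ := (0, 0)
def ptA : ℝ × ℝ := (3, 1)
def ptB : ℝ × ℝ := (9 / 4, 0)
def ptD : ℝ × ℝ := (135 / 64, 0)
def ptE : ℝ × ℝ := (45 / 16, 25 / 32)

/-- `γ` is a simple (non-self-intersecting) arc in the plane with endpoints `Y` and `Z`. -/
def IsSimpleArc (γ : Set (ℝ × ℝ)) (Y Z : ℝ × ℝ) : Prop :=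
  ∃ f : Path Y Z, Function.Injective f ∧ Set.range f = γ

/-- `T` is the (open) curvilinear triangle with vertices `U, V, W` and sides `UV`, `VW`, `WU`: the
sides are simple arcs that meet only at the common vertices, and `T` is a bounded domain whose
boundary is the closed curve formed by the three sides (hence `T` is the interior of this curve). -/
def IsCurvilinearTriangle (T : Set (ℝ × ℝ)) (U V W : ℝ × ℝ) (UV VW WU : Set (ℝ × ℝ)) : Prop :=
  IsSimpleArc UV U V ∧ IsSimpleArc VW V W ∧ IsSimpleArc WU W U ∧
  UV ∩ VW = {V} ∧ VW ∩ WU = {W} ∧ WU ∩ UV = {U} ∧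
  IsOpen T ∧ IsConnected T ∧ Bornology.IsBounded T ∧ frontier T = UV ∪ VW ∪ WU

end

end MorseQuintic

/-! A monic quintic with four distinct real critical points can be moved by an increasing affine
change of variable so that its largest critical point is 0 and the other three, r < s < t < 0, have
sum -3. Up to an additive constant and a positive factor it is then some `p u` with r, s, t the
roots of `q u`. The order of the critical values, hence the passport, is unchanged
(`exists_normalization`). So everything reduces to ordering p(r), p(s), p(t) and p(0) = 0.

Integrating p' between two critical points x < y gives p(x) - p(y) = (y - x)³/24 times a quadratic
form `conic` in the critical points. Up to a constant, `g` is the product of the three conics of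
pairs of roots of `q`, and `h` that of the three pairs containing 0. For neighbouring critical
points the sign is forced: p(s) < p(r), p(s) < p(t), 0 < p(t). Only p(r) against p(t), p(s) against
0 and p(r) against 0 remain free; they leave the eleven orders of `pattern_cases`.

These three signs become transparent in a chart of the triangle OAB. Divide the gaps s - r, t - s,
-t by their sum and write them as (1 - l)(1 - w), w, l(1 - w), with (l, w) in the unit square. A
conic is homogeneous quadratic in the gaps, so for fixed l it is a quadratic in w; each of the three
free conics is positive below a single threshold and negative above it (`exists_quadratic_eq`). The
loci p(r) = p(t), p(s) = 0, p(r) = 0 are therefore graphs `curveRT`, `curveS`, `curveR` over l. The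
first two cross exactly at l = 1/2, which gives the point F, and both lie below the third, touching
it only at l = 0 and at l = 1 respectively. The five triangles are the cells between these graphs,
and `chart_cases` reads off the passport in each.

What remains is to carry this picture to the (b, c)-plane. The map `chart` is continuous on the
compact square and injective except that the whole top edge w = 1 goes to B (`chart_eq_chart`).
Compactness turns cells into open sets with the expected closures and frontiers
(`IsCell.isOpen_image`, `IsCell.frontier_image`), and graphs and edges become simple arcs.
Realisability of each passport follows because cells, and arcs without endpoints, are nonempty. -/

namespace MorseQuintic

/-! ### Passports of polynomials with four critical points -/

/-- The relative order of four values: the entry of a value is its number among the distinct values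
in increasing order. -/
noncomputable def pattern (a b c d : ℝ) : List ℕ :=
  [a, b, c, d].map fun v => (({a, b, c, d} : Finset ℝ).filter (fun w => w ≤ v)).card

theorem passport_eq_pattern {P : ℝ[X]} {x₁ x₂ x₃ x₄ : ℝ} (h₁ : x₁ < x₂) (h₂ : x₂ < x₃)
    (h₃ : x₃ < x₄) (h : criticalPoints P = {x₁, x₂, x₃, x₄}) :
    passport P = pattern (P.eval x₁) (P.eval x₂) (P.eval x₃) (P.eval x₄) := by
  have hs : (criticalPoints P).sort (fun x y => x ≤ y) = [x₁, x₂, x₃, x₄] := by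
    rw [h]
    rw [Finset.sort_insert, Finset.sort_insert, Finset.sort_insert, Finset.sort_singleton]
    all_goals simp
    all_goals (try constructor)
    all_goals (try constructor)
    all_goals linarith
  have hv : criticalValues P = {P.eval x₁, P.eval x₂, P.eval x₃, P.eval x₄} := by
    simp [criticalValues, h, Finset.image_insert]
  simp only [passport, hs, pattern, valueNumber, hv, List.map_cons, List.map_nil]

/-- Only the order of the values enters. Applied to v ↦ k⁵v + m, this makes the passport invariant
under normalisation. -/
theorem pattern_comp {f : ℝ → ℝ} (hf : StrictMono f) (a b c d : ℝ) :
    pattern (f a) (f b) (f c) (f d) = pattern a b c d := by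
  have hi : ({f a, f b, f c, f d} : Finset ℝ) = ({a, b, c, d} : Finset ℝ).image f := by
    simp [Finset.image_insert]
  have hc (v : ℝ) : (({f a, f b, f c, f d} : Finset ℝ).filter (fun w => w ≤ f v)).card =
      (({a, b, c, d} : Finset ℝ).filter (fun w => w ≤ v)).card := by
    rw [hi, Finset.filter_image, Finset.card_image_of_injective _ hf.injective]
    simp only [hf.le_iff_le]
  simp only [pattern, List.map_cons, List.map_nil, hc]

theorem pattern_4231 {a b c d : ℝ} (h₁ : d < b) (h₂ : b < c) (h₃ : c < a) :
    pattern a b c d = [4, 2, 3, 1] ∧ ({a, b, c, d} : Finset ℝ).card = 4 := by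
  have := h₁.trans h₂
  have := h₁.trans (h₂.trans h₃)
  have := h₂.trans h₃
  simp [pattern, Finset.filter_insert, Finset.filter_singleton, not_le_of_gt, le_of_lt, ne_of_gt,
    ne_of_lt, *]

theorem pattern_3231 {a b c d : ℝ} (h₁ : d < b) (h₂ : b < c) (h₃ : c = a) :
    pattern a b c d = [3, 2, 3, 1] ∧ ({a, b, c, d} : Finset ℝ).card = 3 := by
  subst h₃
  have := h₁.trans h₂
  simp [pattern, Finset.filter_insert, Finset.filter_singleton, not_le_of_gt, le_of_lt, ne_of_gt,
    ne_of_lt, *]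

theorem pattern_3241 {a b c d : ℝ} (h₁ : d < b) (h₂ : b < a) (h₃ : a < c) :
    pattern a b c d = [3, 2, 4, 1] ∧ ({a, b, c, d} : Finset ℝ).card = 4 := by
  have := h₁.trans h₂
  have := h₁.trans (h₂.trans h₃)
  have := h₂.trans h₃
  simp [pattern, Finset.filter_insert, Finset.filter_singleton, not_le_of_gt, le_of_lt, ne_of_gt,
    ne_of_lt, *]

theorem pattern_3121 {a b c d : ℝ} (h₁ : d = b) (h₂ : b < c) (h₃ : c < a) :
    pattern a b c d = [3, 1, 2, 1] ∧ ({a, b, c, d} : Finset ℝ).card = 3 := by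
  subst h₁
  have := h₂.trans h₃
  simp [pattern, Finset.filter_insert, Finset.filter_singleton, not_le_of_gt, le_of_lt, ne_of_gt,
    ne_of_lt, *]

theorem pattern_2121 {a b c d : ℝ} (h₁ : d = b) (h₂ : b < c) (h₃ : c = a) :
    pattern a b c d = [2, 1, 2, 1] ∧ ({a, b, c, d} : Finset ℝ).card = 2 := by
  subst h₁
  subst h₃
  simp [pattern, Finset.filter_insert, Finset.filter_singleton, not_le_of_gt, le_of_lt, ne_of_gt,
    ne_of_lt, *]

theorem pattern_2131 {a b c d : ℝ} (h₁ : d = b) (h₂ : b < a) (h₃ : a < c) :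
    pattern a b c d = [2, 1, 3, 1] ∧ ({a, b, c, d} : Finset ℝ).card = 3 := by
  subst h₁
  have := h₂.trans h₃
  simp [pattern, Finset.filter_insert, Finset.filter_singleton, not_le_of_gt, le_of_lt, ne_of_gt,
    ne_of_lt, *]

theorem pattern_4132 {a b c d : ℝ} (h₁ : b < d) (h₂ : d < c) (h₃ : c < a) :
    pattern a b c d = [4, 1, 3, 2] ∧ ({a, b, c, d} : Finset ℝ).card = 4 := by
  have := h₁.trans h₂
  have := h₁.trans (h₂.trans h₃)
  have := h₂.trans h₃
  simp [pattern, Finset.filter_insert, Finset.filter_singleton, not_le_of_gt, le_of_lt, ne_of_gt,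
    ne_of_lt, *]

theorem pattern_3132 {a b c d : ℝ} (h₁ : b < d) (h₂ : d < c) (h₃ : c = a) :
    pattern a b c d = [3, 1, 3, 2] ∧ ({a, b, c, d} : Finset ℝ).card = 3 := by
  subst h₃
  have := h₁.trans h₂
  simp [pattern, Finset.filter_insert, Finset.filter_singleton, not_le_of_gt, le_of_lt, ne_of_gt,
    ne_of_lt, *]

theorem pattern_3142 {a b c d : ℝ} (h₁ : b < d) (h₂ : d < a) (h₃ : a < c) :
    pattern a b c d = [3, 1, 4, 2] ∧ ({a, b, c, d} : Finset ℝ).card = 4 := by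
  have := h₁.trans h₂
  have := h₁.trans (h₂.trans h₃)
  have := h₂.trans h₃
  simp [pattern, Finset.filter_insert, Finset.filter_singleton, not_le_of_gt, le_of_lt, ne_of_gt,
    ne_of_lt, *]

theorem pattern_2132 {a b c d : ℝ} (h₁ : b < d) (h₂ : d = a) (h₃ : a < c) :
    pattern a b c d = [2, 1, 3, 2] ∧ ({a, b, c, d} : Finset ℝ).card = 3 := by
  subst h₂
  have := h₁.trans h₃
  simp [pattern, Finset.filter_insert, Finset.filter_singleton, not_le_of_gt, le_of_lt, ne_of_gt,
    ne_of_lt, *]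

theorem pattern_2143 {a b c d : ℝ} (h₁ : b < a) (h₂ : a < d) (h₃ : d < c) :
    pattern a b c d = [2, 1, 4, 3] ∧ ({a, b, c, d} : Finset ℝ).card = 4 := by
  have := h₁.trans h₂
  have := h₁.trans (h₂.trans h₃)
  have := h₂.trans h₃
  simp [pattern, Finset.filter_insert, Finset.filter_singleton, not_le_of_gt, le_of_lt, ne_of_gt,
    ne_of_lt, *]

/-- The eleven possible orders of the values at four consecutive critical points of a quintic. -/
theorem pattern_cases {a b c d : ℝ} (hab : b < a) (hbc : b < c) (hcd : d < c) :
    (d < b ∧ c < a ∧ pattern a b c d = [4, 2, 3, 1] ∧ ({a, b, c, d} : Finset ℝ).card = 4) ∨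
    (d < b ∧ a = c ∧ pattern a b c d = [3, 2, 3, 1] ∧ ({a, b, c, d} : Finset ℝ).card = 3) ∨
    (d < b ∧ a < c ∧ pattern a b c d = [3, 2, 4, 1] ∧ ({a, b, c, d} : Finset ℝ).card = 4) ∨
    (b = d ∧ c < a ∧ pattern a b c d = [3, 1, 2, 1] ∧ ({a, b, c, d} : Finset ℝ).card = 3) ∨
    (b = d ∧ a = c ∧ pattern a b c d = [2, 1, 2, 1] ∧ ({a, b, c, d} : Finset ℝ).card = 2) ∨
    (b = d ∧ a < c ∧ pattern a b c d = [2, 1, 3, 1] ∧ ({a, b, c, d} : Finset ℝ).card = 3) ∨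
    (b < d ∧ c < a ∧ pattern a b c d = [4, 1, 3, 2] ∧ ({a, b, c, d} : Finset ℝ).card = 4) ∨
    (b < d ∧ a = c ∧ pattern a b c d = [3, 1, 3, 2] ∧ ({a, b, c, d} : Finset ℝ).card = 3) ∨
    (b < d ∧ a < c ∧ d < a ∧ pattern a b c d = [3, 1, 4, 2] ∧
      ({a, b, c, d} : Finset ℝ).card = 4) ∨
    (a = d ∧ pattern a b c d = [2, 1, 3, 2] ∧ ({a, b, c, d} : Finset ℝ).card = 3) ∨
    (a < d ∧ pattern a b c d = [2, 1, 4, 3] ∧ ({a, b, c, d} : Finset ℝ).card = 4) := by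
  -- Of the nine combinations only b < d, a < c leaves a further comparison open, that of a with d;
  -- it splits in three, which gives eleven cases.
  rcases lt_trichotomy b d with h₁ | h₁ | h₁ <;> rcases lt_trichotomy a c with h₂ | h₂ | h₂
  · rcases lt_trichotomy a d with h₃ | h₃ | h₃
    · iterate 10 right
      exact ⟨h₃, pattern_2143 hab h₃ hcd⟩
    · iterate 9 right
      left
      exact ⟨h₃, pattern_2132 h₁ h₃.symm h₂⟩
    · iterate 8 right
      left
      exact ⟨h₁, h₂, h₃, pattern_3142 h₁ h₃ h₂⟩
  · iterate 7 right
    left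
    exact ⟨h₁, h₂, pattern_3132 h₁ hcd h₂.symm⟩
  · iterate 6 right
    left
    exact ⟨h₁, h₂, pattern_4132 h₁ hcd h₂⟩
  · iterate 5 right
    left
    exact ⟨h₁, h₂, pattern_2131 h₁.symm hab h₂⟩
  · iterate 4 right
    left
    exact ⟨h₁, h₂, pattern_2121 h₁.symm hbc h₂.symm⟩
  · iterate 3 right
    left
    exact ⟨h₁, h₂, pattern_3121 h₁.symm hbc h₂⟩
  · iterate 2 right
    left
    exact ⟨h₁, h₂, pattern_3241 h₁ hab h₂⟩
  · iterate 1 right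
    left
    exact ⟨h₁, h₂, pattern_3231 h₁ hbc h₂.symm⟩
  · left
    exact ⟨h₁, h₂, pattern_4231 h₁ hbc h₂⟩

/-! ### Quintics with four real critical points -/

section FourCriticalPoints

variable {P : ℝ[X]} {x₁ x₂ x₃ x₄ : ℝ}

theorem roots_derivative_eq
    (hd : derivative P = C 5 * ((X - C x₁) * (X - C x₂) * (X - C x₃) * (X - C x₄))) :
    (derivative P).roots = {x₁, x₂, x₃, x₄} := by
  have h : (X - C x₁) * (X - C x₂) * (X - C x₃) * (X - C x₄) =
      (({x₁, x₂, x₃, x₄} : Multiset ℝ).map fun a => X - C a).prod := by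
    simp [mul_assoc]
  rw [hd, roots_C_mul _ (by norm_num), h, roots_multiset_prod_X_sub_C]

theorem criticalPoints_eq
    (hd : derivative P = C 5 * ((X - C x₁) * (X - C x₂) * (X - C x₃) * (X - C x₄))) :
    criticalPoints P = {x₁, x₂, x₃, x₄} := by
  rw [criticalPoints, roots_derivative_eq hd]
  ext; simp

theorem criticalValues_eq
    (hd : derivative P = C 5 * ((X - C x₁) * (X - C x₂) * (X - C x₃) * (X - C x₄))) :
    criticalValues P = {P.eval x₁, P.eval x₂, P.eval x₃, P.eval x₄} := by
  simp [criticalValues, criticalPoints_eq hd, Finset.image_insert]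

theorem card_criticalPoints (h₁ : x₁ < x₂) (h₂ : x₂ < x₃) (h₃ : x₃ < x₄)
    (hd : derivative P = C 5 * ((X - C x₁) * (X - C x₂) * (X - C x₃) * (X - C x₄))) :
    (criticalPoints P).card = 4 := by
  have := h₁.trans h₂
  have := h₂.trans h₃
  have := h₁.trans (h₂.trans h₃)
  simp [criticalPoints_eq hd, ne_of_lt, *]

/-- The derivative splits with simple roots, so only injectivity of P on its four critical points is
left, and that means four values. -/
theorem isMorse_iff_card (hP : P.Monic) (h₁ : x₁ < x₂) (h₂ : x₂ < x₃) (h₃ : x₃ < x₄)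
    (hd : derivative P = C 5 * ((X - C x₁) * (X - C x₂) * (X - C x₃) * (X - C x₄))) :
    IsMorse P ↔ (criticalValues P).card = 4 := by
  have hsplit : (derivative P).Splits := by
    rw [hd]
    exact ((((Splits.X_sub_C _).mul (Splits.X_sub_C _)).mul (Splits.X_sub_C _)).mul
      (Splits.X_sub_C _)).C_mul _
  have hnodup : (derivative P).roots.Nodup := by
    have := h₁.trans h₂
    have := h₂.trans h₃
    have := h₁.trans (h₂.trans h₃)
    rw [roots_derivative_eq hd]
    simp [ne_of_lt, *]
  have hne : derivative P ≠ 0 := by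
    intro h0
    have := roots_derivative_eq hd
    rw [h0] at this
    simp at this
  have hset : {x | (derivative P).IsRoot x} = (criticalPoints P : Set ℝ) := by
    ext x; simp [criticalPoints, hne]
  rw [← card_criticalPoints h₁ h₂ h₃ hd, criticalValues, Finset.card_image_iff, ← hset]
  simp [IsMorse, hP, hsplit, hnodup]

end FourCriticalPoints

/-- Four distinct real roots exhaust the degree of the derivative, so it splits and its roots are
simple. -/
theorem exists_derivative_eq {P : ℝ[X]} (hP : P.Monic) (h5 : P.natDegree = 5)
    (hc : (criticalPoints P).card = 4) :
    ∃ x₁ x₂ x₃ x₄ : ℝ, x₁ < x₂ ∧ x₂ < x₃ ∧ x₃ < x₄ ∧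
      derivative P = C 5 * ((X - C x₁) * (X - C x₂) * (X - C x₃) * (X - C x₄)) := by
  have hdeg : (derivative P).natDegree = 4 := by
    rw [natDegree_derivative, h5]
  have hlead : (derivative P).leadingCoeff = 5 := by
    rw [leadingCoeff, hdeg, coeff_derivative]
    have : P.coeff 5 = 1 := by rw [← h5]; exact hP
    norm_num [this]
  have hle : (derivative P).roots.card ≤ 4 := hdeg ▸ card_roots' _
  have hge := Multiset.toFinset_card_le (derivative P).roots
  rw [criticalPoints] at hc
  have hcard : (derivative P).roots.card = 4 := by omega
  have hval : (derivative P).roots.toFinset.val = (derivative P).roots :=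
    (Multiset.toFinset_val _).trans
      (Multiset.dedup_eq_self.2 (Multiset.toFinset_card_eq_card_iff_nodup.1 (by omega)))
  have hprod := (splits_iff_card_roots.2 (hcard.trans hdeg.symm)).eq_prod_roots
  set e := (derivative P).roots.toFinset.orderEmbOfFin hc
  have himg : (derivative P).roots.toFinset = Finset.univ.image e := by
    rw [← Finset.coe_inj]; simp [e]
  refine ⟨e 0, e 1, e 2, e 3, e.strictMono (by decide), e.strictMono (by decide),
    e.strictMono (by decide), ?_⟩
  have hp' : ((derivative P).roots.map fun a => X - C a).prod =
      ∏ i, (X - C (e i)) := by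
    rw [← hval, himg, ← Finset.prod_image (f := fun a => X - C a) e.injective.injOn]
    rfl
  rw [hprod, hlead, hp', Fin.prod_univ_four]

theorem card_criticalPoints_of_isMorse {P : ℝ[X]} (h5 : P.natDegree = 5) (hM : IsMorse P) :
    (criticalPoints P).card = 4 := by
  obtain ⟨-, hs, hn, -⟩ := hM
  rw [criticalPoints, Multiset.toFinset_card_of_nodup hn, ← hs.natDegree_eq_card_roots,
    natDegree_derivative, h5]

/-! ### The family `p` -/

theorem q_eq_iff (u : ℝ × ℝ) (r s t : ℝ) :
    q u = (X - C r) * (X - C s) * (X - C t) ↔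
      r + s + t = -3 ∧ u.1 = r * s + r * t + s * t ∧ u.2 = -(r * s * t) := by
  constructor
  · intro h
    have h0 := congrArg (eval 0) h
    have h1 := congrArg (eval 1) h
    have h2 := congrArg (eval (-1)) h
    simp [q] at h0 h1 h2
    refine ⟨?_, ?_, ?_⟩ <;> linarith
  · rintro ⟨h1, h2, h3⟩
    have h4 : (3 : ℝ) = -(r + s + t) := by linarith
    rw [q, h2, h3, h4]
    simp only [map_neg, map_add, map_mul]
    ring

theorem derivative_p (u : ℝ × ℝ) : derivative (p u) = C 5 * (X * q u) := by
  simp only [p, q, derivative_add, derivative_C_mul, derivative_X_pow]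
  apply Polynomial.funext
  intro x
  simp
  ring

theorem eval_p (u : ℝ × ℝ) (x : ℝ) :
    (p u).eval x = x ^ 5 + 15 / 4 * x ^ 4 + 5 * u.1 / 3 * x ^ 3 + 5 * u.2 / 2 * x ^ 2 := by
  simp [p]

theorem eval_q (u : ℝ × ℝ) (x : ℝ) : (q u).eval x = x ^ 3 + 3 * x ^ 2 + u.1 * x + u.2 := by
  simp [q]

theorem degree_p (u : ℝ × ℝ) : (p u).degree = 5 := by
  rw [p]; compute_degree!

theorem natDegree_p (u : ℝ × ℝ) : (p u).natDegree = 5 :=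
  natDegree_eq_of_degree_eq_some (degree_p u)

theorem monic_p (u : ℝ × ℝ) : (p u).Monic := by
  rw [p]; monicity!

theorem discr_q (u : ℝ × ℝ) : (q u).discr = dq u := by
  have hd : (q u).degree = 3 := by rw [q]; compute_degree!
  rw [discr_of_degree_eq_three hd]
  simp [q, coeff_X, coeff_C, dq, coeff_X_pow]
  ring

theorem derivative_p_of_roots {u : ℝ × ℝ} {r s t : ℝ}
    (hq : q u = (X - C r) * (X - C s) * (X - C t)) :
    derivative (p u) = C 5 * ((X - C r) * (X - C s) * (X - C t) * (X - C 0)) := by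
  rw [derivative_p, hq, C_0]; ring

theorem exists_comp_eq_of_derivative_eq {P : ℝ[X]} {u : ℝ × ℝ} {k l : ℝ}
    (h : derivative (P.comp (C k * X + C l)) = C (k ^ 5) * derivative (p u)) :
    ∃ m, P.comp (C k * X + C l) = C (k ^ 5) * p u + C m := by
  have h0 : derivative (P.comp (C k * X + C l) - C (k ^ 5) * p u) = 0 := by
    rw [derivative_sub, h, derivative_C_mul, sub_self]
  obtain ⟨m, hm⟩ := natDegree_eq_zero.1 (derivative_eq_zero.1 h0)
  exact ⟨m, by rw [hm]; ring⟩

/-- Every monic quintic with four real critical points is affinely equivalent to some `p u`. -/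
theorem exists_normalization {P : ℝ[X]} (hP : P.Monic) (h5 : P.natDegree = 5)
    (hc : (criticalPoints P).card = 4) :
    ∃ u ∈ region, ∃ k l m : ℝ, 0 < k ∧ P.comp (C k * X + C l) = C (k ^ 5) * p u + C m ∧
      (criticalValues (p u)).card = (criticalValues P).card ∧ passport (p u) = passport P ∧
      (IsMorse (p u) ↔ IsMorse P) := by
  obtain ⟨x₁, x₂, x₃, x₄, h₁, h₂, h₃, hd⟩ := exists_derivative_eq hP h5 hc
  -- With x₄ sent to 0, this scale makes the other three critical points sum to -3, as the
  -- x²-coefficient of `q` demands.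
  obtain ⟨k, hk⟩ : ∃ k : ℝ, k = (3 * x₄ - x₁ - x₂ - x₃) / 3 := ⟨_, rfl⟩
  have hk0 : 0 < k := by rw [hk]; linarith
  obtain ⟨r, hr⟩ : ∃ r, x₁ = k * r + x₄ := ⟨(x₁ - x₄) / k, by field_simp; ring⟩
  obtain ⟨s, hs⟩ : ∃ s, x₂ = k * s + x₄ := ⟨(x₂ - x₄) / k, by field_simp; ring⟩
  obtain ⟨t, ht⟩ : ∃ t, x₃ = k * t + x₄ := ⟨(x₃ - x₄) / k, by field_simp; ring⟩
  have hsum : r + s + t = -3 := by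
    have : k * (r + s + t) = k * (-3) := by linarith
    exact mul_left_cancel₀ hk0.ne' this
  have hrs : r < s := by
    rw [hr, hs] at h₁; exact lt_of_mul_lt_mul_left (by linarith) hk0.le
  have hst : s < t := by
    rw [hs, ht] at h₂; exact lt_of_mul_lt_mul_left (by linarith) hk0.le
  have ht0 : t < 0 := by
    rw [ht] at h₃; exact lt_of_mul_lt_mul_left (a := k) (by linarith) hk0.le
  obtain ⟨u, hu⟩ : ∃ u : ℝ × ℝ, u = (r * s + r * t + s * t, -(r * s * t)) := ⟨_, rfl⟩
  have hq : q u = (X - C r) * (X - C s) * (X - C t) :=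
    (q_eq_iff u r s t).2 ⟨hsum, by rw [hu], by rw [hu]⟩
  have hpd := derivative_p_of_roots hq
  obtain ⟨m, hm⟩ : ∃ m, P.comp (C k * X + C x₄) = C (k ^ 5) * p u + C m := by
    apply exists_comp_eq_of_derivative_eq
    rw [derivative_comp, hd, hpd, hr, hs, ht]
    apply Polynomial.funext
    intro x
    simp
    ring
  have hev (x : ℝ) : P.eval (k * x + x₄) = k ^ 5 * (p u).eval x + m := by
    have := congrArg (eval x) hm
    simpa using this
  have hmono : StrictMono fun v : ℝ => k ^ 5 * v + m := fun a b hab => by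
    have : 0 < k ^ 5 := by positivity
    simp only
    gcongr
  have hcv : (criticalValues (p u)).card = (criticalValues P).card := by
    rw [← Finset.card_image_of_injective _ hmono.injective, criticalValues_eq hd,
      criticalValues_eq hpd]
    have h0 := hev 0
    simp only [mul_zero, zero_add] at h0
    rw [hr, hs, ht, hev, hev, hev, h0]
    simp [Finset.image_insert]
  refine ⟨u, ⟨r, s, t, hrs, hst, ht0, hq⟩, k, x₄, m, hk0, hm, hcv, ?_, ?_⟩
  · rw [passport_eq_pattern hrs hst ht0 (criticalPoints_eq hpd),
      passport_eq_pattern h₁ h₂ h₃ (criticalPoints_eq hd), ← pattern_comp hmono]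
    have h0 := hev 0
    simp only [mul_zero, zero_add] at h0
    rw [hr, hs, ht, hev, hev, hev, h0]
  · rw [isMorse_iff_card (monic_p u) hrs hst ht0 hpd, isMorse_iff_card hP h₁ h₂ h₃ hd, hcv]

/-! ### Critical values in terms of the roots of `q` -/

/-- `r`, `s`, `t` are the roots of `q u`, expressed through the coefficients. -/
def HasRoots (u : ℝ × ℝ) (r s t : ℝ) : Prop :=
  r + s + t = -3 ∧ u.1 = r * s + r * t + s * t ∧ u.2 = -(r * s * t)

/-- The quadratic factor of the difference of the values at the critical points `x` and `y` of a
quintic whose other two critical points are `z` and `w`. -/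
def conic (x y z w : ℝ) : ℝ := (y - x) ^ 2 + 5 * (x + y - 2 * z) * (x + y - 2 * w)

theorem mem_region_iff {u : ℝ × ℝ} :
    u ∈ region ↔ ∃ r s t : ℝ, r < s ∧ s < t ∧ t < 0 ∧ HasRoots u r s t := by
  simp only [region, HasRoots, Set.mem_ofPred_eq, q_eq_iff]

section HasRoots

variable {u : ℝ × ℝ} {r s t : ℝ}

theorem HasRoots.isRoot_iff (hu : HasRoots u r s t) (x : ℝ) :
    (q u).IsRoot x ↔ x = r ∨ x = s ∨ x = t := by
  rw [(q_eq_iff u r s t).2 hu]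
  simp [sub_eq_zero, or_assoc]

/-- This is minus the integral of p' over [r, s], computed about the midpoint of the interval, where
the odd terms cancel. The five lemmas that follow treat the other pairs; in each, one root is
eliminated by r + s + t = -3, which leaves a polynomial identity. -/
theorem HasRoots.eval_sub_rs (hu : HasRoots u r s t) :
    (p u).eval r - (p u).eval s = (s - r) ^ 3 / 24 * conic r s t 0 := by
  obtain ⟨h1, h2, h3⟩ := hu
  obtain rfl : t = -3 - r - s := by linarith
  rw [eval_p, eval_p, h2, h3, conic]; ring

theorem HasRoots.eval_sub_st (hu : HasRoots u r s t) :
    (p u).eval s - (p u).eval t = (t - s) ^ 3 / 24 * conic s t r 0 := by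
  obtain ⟨h1, h2, h3⟩ := hu
  obtain rfl : r = -3 - s - t := by linarith
  rw [eval_p, eval_p, h2, h3, conic]; ring

theorem HasRoots.eval_sub_rt (hu : HasRoots u r s t) :
    (p u).eval r - (p u).eval t = (t - r) ^ 3 / 24 * conic r t s 0 := by
  obtain ⟨h1, h2, h3⟩ := hu
  obtain rfl : s = -3 - r - t := by linarith
  rw [eval_p, eval_p, h2, h3, conic]; ring

theorem HasRoots.eval_r (hu : HasRoots u r s t) :
    (p u).eval r = (-r) ^ 3 / 24 * conic r 0 s t := by
  obtain ⟨h1, h2, h3⟩ := hu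
  obtain rfl : t = -3 - r - s := by linarith
  rw [eval_p, h2, h3, conic]; ring

theorem HasRoots.eval_s (hu : HasRoots u r s t) :
    (p u).eval s = (-s) ^ 3 / 24 * conic s 0 r t := by
  obtain ⟨h1, h2, h3⟩ := hu
  obtain rfl : t = -3 - r - s := by linarith
  rw [eval_p, h2, h3, conic]; ring

theorem HasRoots.eval_t (hu : HasRoots u r s t) :
    (p u).eval t = (-t) ^ 3 / 24 * conic t 0 r s := by
  obtain ⟨h1, h2, h3⟩ := hu
  obtain rfl : r = -3 - s - t := by linarith
  rw [eval_p, h2, h3, conic]; ring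

/-- The product of the conics over all pairs of roots of `q` is symmetric in the roots, hence a
polynomial in b and c. `HasRoots.h_eq` does the same for the pairs formed with the critical point 0.
-/
theorem HasRoots.g_eq (hu : HasRoots u r s t) :
    -8 * g u = conic r s t 0 * conic s t r 0 * conic r t s 0 := by
  obtain ⟨h1, h2, h3⟩ := hu
  obtain rfl : t = -3 - r - s := by linarith
  rw [g, h2, h3]; simp only [conic]; ring

theorem HasRoots.h_eq (hu : HasRoots u r s t) :
    8 * h u = conic r 0 s t * conic s 0 r t * conic t 0 r s := by
  obtain ⟨h1, h2, h3⟩ := hu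
  obtain rfl : t = -3 - r - s := by linarith
  rw [h, h2, h3]; simp only [conic]; ring

theorem HasRoots.dq_eq (hu : HasRoots u r s t) :
    dq u = ((s - r) * (t - s) * (t - r)) ^ 2 := by
  obtain ⟨h1, h2, h3⟩ := hu
  obtain rfl : t = -3 - r - s := by linarith
  rw [dq, h2, h3]; ring

/-- The midpoint of the two leftmost critical points lies to the left of the other two, so the
product in `conic` has two factors of the same sign. `conic_t_pos` is the mirror image. -/
theorem conic_rs_pos (hrs : r < s) (hst : s < t) (ht : t < 0) : 0 < conic r s t 0 := by
  have : 0 < (2 * t - r - s) * (-r - s) := mul_pos (by linarith) (by linarith)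
  rw [conic]; nlinarith [sq_nonneg (s - r)]

/-- The midpoint of the middle pair separates the two outer critical points, so the product is
negative; each of its factors exceeds t - s in absolute value, so it dominates the square. -/
theorem conic_st_neg (hrs : r < s) (hst : s < t) (ht : t < 0) : conic s t r 0 < 0 := by
  have h1 : (t - s) * (t - s) < (s + t - 2 * r) * (-(s + t)) :=
    mul_lt_mul'' (by linarith) (by linarith) (by linarith) (by linarith)
  rw [conic]; nlinarith [mul_self_nonneg (t - s)]

theorem conic_t_pos (hrs : r < s) (hst : s < t) (ht : t < 0) : 0 < conic t 0 r s := by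
  have : 0 < (t - 2 * r) * (t - 2 * s) := mul_pos (by linarith) (by linarith)
  rw [conic]; nlinarith [sq_nonneg t]

theorem eval_s_lt_eval_r (hrs : r < s) (hst : s < t) (ht : t < 0) (hu : HasRoots u r s t) :
    (p u).eval s < (p u).eval r := by
  have h1 := hu.eval_sub_rs
  have h2 : 0 < (s - r) ^ 3 / 24 * conic r s t 0 :=
    mul_pos (by have := sub_pos.2 hrs; positivity) (conic_rs_pos hrs hst ht)
  linarith

theorem eval_s_lt_eval_t (hrs : r < s) (hst : s < t) (ht : t < 0) (hu : HasRoots u r s t) :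
    (p u).eval s < (p u).eval t := by
  have h1 := hu.eval_sub_st
  have h2 : (t - s) ^ 3 / 24 * conic s t r 0 < 0 :=
    mul_neg_of_pos_of_neg (by have := sub_pos.2 hst; positivity) (conic_st_neg hrs hst ht)
  linarith

theorem eval_t_pos (hrs : r < s) (hst : s < t) (ht : t < 0) (hu : HasRoots u r s t) :
    0 < (p u).eval t := by
  rw [hu.eval_t]
  exact mul_pos (by have := neg_pos.2 ht; positivity) (conic_t_pos hrs hst ht)

/-- Of the three factors of `g`, those of the neighbouring pairs have a strict sign; only the one of
r and t can vanish. -/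
theorem g_eq_zero_iff_eval (hrs : r < s) (hst : s < t) (ht : t < 0) (hu : HasRoots u r s t) :
    g u = 0 ↔ (p u).eval r = (p u).eval t := by
  have h1 := hu.g_eq
  have h2 := hu.eval_sub_rt
  have h3 : (t - r) ^ 3 / 24 ≠ 0 := by
    have : 0 < t - r := by linarith
    positivity
  rw [← sub_eq_zero (a := eval r _), h2, mul_eq_zero_iff_left h3]
  have h4 := mul_ne_zero (conic_rs_pos hrs hst ht).ne' (conic_st_neg hrs hst ht).ne
  rw [← mul_eq_zero_iff_left (b := conic r t s 0) h4, ← h1]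
  simp

theorem h_eq_zero_iff_eval (hrs : r < s) (hst : s < t) (ht : t < 0) (hu : HasRoots u r s t) :
    h u = 0 ↔ (p u).eval r = 0 ∨ (p u).eval s = 0 := by
  have h1 := hu.h_eq
  have h3 : (-r) ^ 3 / 24 ≠ 0 := by
    have : 0 < -r := by linarith
    positivity
  have h4 : (-s) ^ 3 / 24 ≠ 0 := by
    have : 0 < -s := by linarith
    positivity
  rw [hu.eval_r, hu.eval_s, mul_eq_zero_iff_left h3, mul_eq_zero_iff_left h4, ← mul_eq_zero,
    ← mul_eq_zero_iff_right (a := conic r 0 s t * _) (conic_t_pos hrs hst ht).ne', ← h1]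
  simp

theorem passport_p_eq (hrs : r < s) (hst : s < t) (ht : t < 0) (hu : HasRoots u r s t) :
    passport (p u) = pattern ((p u).eval r) ((p u).eval s) ((p u).eval t) 0 := by
  rw [passport_eq_pattern hrs hst ht
    (criticalPoints_eq (derivative_p_of_roots ((q_eq_iff u r s t).2 hu)))]
  simp [eval_p]

theorem criticalValues_p_eq (hu : HasRoots u r s t) :
    criticalValues (p u) = {(p u).eval r, (p u).eval s, (p u).eval t, 0} := by
  rw [criticalValues_eq (derivative_p_of_roots ((q_eq_iff u r s t).2 hu))]
  simp [eval_p]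

theorem isMorse_p_iff (hrs : r < s) (hst : s < t) (ht : t < 0) (hu : HasRoots u r s t) :
    IsMorse (p u) ↔ ({(p u).eval r, (p u).eval s, (p u).eval t, 0} : Finset ℝ).card = 4 := by
  rw [isMorse_iff_card (monic_p u) hrs hst ht
    (derivative_p_of_roots ((q_eq_iff u r s t).2 hu)), criticalValues_p_eq hu]

theorem isDegenerateSnake_p_iff (hrs : r < s) (hst : s < t) (ht : t < 0)
    (hu : HasRoots u r s t) :
    IsDegenerateSnake (p u) ↔
      ({(p u).eval r, (p u).eval s, (p u).eval t, 0} : Finset ℝ).card = 3 := by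
  rw [IsDegenerateSnake, criticalValues_p_eq hu, card_criticalPoints hrs hst ht
    (derivative_p_of_roots ((q_eq_iff u r s t).2 hu))]
  simp [monic_p, natDegree_p]

end HasRoots

theorem g_eq_zero_iff {u : ℝ × ℝ} (hu : u ∈ region) : g u = 0 ↔
    ∃ x y : ℝ, x ≠ y ∧ (q u).IsRoot x ∧ (q u).IsRoot y ∧ (p u).eval x = (p u).eval y := by
  obtain ⟨r, s, t, hrs, hst, ht, hu⟩ := mem_region_iff.1 hu
  simp only [hu.isRoot_iff, g_eq_zero_iff_eval hrs hst ht hu]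
  have h1 := eval_s_lt_eval_r hrs hst ht hu
  have h2 := eval_s_lt_eval_t hrs hst ht hu
  constructor
  · exact fun h => ⟨r, t, by linarith, by simp, by simp, h⟩
  · rintro ⟨x, y, hxy, rfl | rfl | rfl, rfl | rfl | rfl, h⟩ <;>
      first | exact absurd rfl hxy | linarith

theorem h_eq_zero_iff {u : ℝ × ℝ} (hu : u ∈ region) :
    h u = 0 ↔ ∃ x : ℝ, (q u).IsRoot x ∧ (p u).eval x = 0 := by
  obtain ⟨r, s, t, hrs, hst, ht, hu⟩ := mem_region_iff.1 hu
  simp only [hu.isRoot_iff, h_eq_zero_iff_eval hrs hst ht hu]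
  have h1 := eval_t_pos hrs hst ht hu
  constructor
  · rintro (h | h)
    · exact ⟨r, by simp, h⟩
    · exact ⟨s, by simp, h⟩
  · rintro ⟨x, rfl | rfl | rfl, h⟩
    · exact Or.inl h
    · exact Or.inr h
    · exact absurd h (ne_of_gt h1)

/-! ### The discriminant curve -/

/-- One real root x comes from the intermediate value theorem. `dq` is the discriminant of the
complementary quadratic times a square, so `0 ≤ dq u` makes that quadratic split; nonnegative
coefficients exclude positive roots. -/
theorem exists_sorted_hasRoots {u : ℝ × ℝ} (hb : 0 ≤ u.1) (hc : 0 ≤ u.2) (hd : 0 ≤ dq u) :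
    ∃ r s t : ℝ, r ≤ s ∧ s ≤ t ∧ t ≤ 0 ∧ HasRoots u r s t := by
  obtain ⟨b, c⟩ := u
  simp only at hb hc
  -- With M = 4 + b + c the cubic at -M equals -M²(1 + b + c) - bM + c ≤ 0, while at 0 it equals c ≥
  -- 0.
  obtain ⟨x, -, hx⟩ : ∃ x ∈ Set.Icc (-(4 + b + c)) 0, x ^ 3 + 3 * x ^ 2 + b * x + c = 0 := by
    have hcont : ContinuousOn (fun x : ℝ => x ^ 3 + 3 * x ^ 2 + b * x + c)
        (Set.Icc (-(4 + b + c)) 0) := by fun_prop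
    refine intermediate_value_Icc (by linarith) hcont ⟨?_, by simpa using hc⟩
    have : 0 ≤ (4 + b + c) * (1 + b + c) * (4 + b + c) := by positivity
    nlinarith [mul_nonneg hb hb, mul_nonneg hb hc, mul_nonneg hc hc]
  obtain ⟨e, he⟩ : ∃ e, e = b + x * (3 + x) := ⟨_, rfl⟩
  have hbe : b = e - x * (3 + x) := by linarith
  have hce : c = -(x * e) := by rw [he]; linear_combination hx
  have hdisc : dq (b, c) = ((3 + x) ^ 2 - 4 * e) * (x ^ 2 + (3 + x) * x + e) ^ 2 := by
    rw [dq]; simp only; rw [hbe, hce]; ring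
  -- If the quadratic factor had no real root, its value at x, the quantity squared in `hdisc`,
  -- would be positive and `dq` would be negative.
  have hD : 0 ≤ (3 + x) ^ 2 - 4 * e := by
    by_contra! hneg
    have hpos : 0 < x ^ 2 + (3 + x) * x + e := by nlinarith [sq_nonneg (2 * x + (3 + x))]
    have : ((3 + x) ^ 2 - 4 * e) * (x ^ 2 + (3 + x) * x + e) ^ 2 < 0 :=
      mul_neg_of_neg_of_pos hneg (by positivity)
    linarith
  obtain ⟨y, z, hyz, hy, hz⟩ : ∃ y z : ℝ, y ≤ z ∧ y + z = -(3 + x) ∧ y * z = e := by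
    have hsq := Real.sq_sqrt hD
    have hnn := Real.sqrt_nonneg ((3 + x) ^ 2 - 4 * e)
    refine ⟨(-(3 + x) - √((3 + x) ^ 2 - 4 * e)) / 2, (-(3 + x) + √((3 + x) ^ 2 - 4 * e)) / 2,
      by linarith, by ring, by linear_combination (-1 / 4) * hsq⟩
  have hroot (a : ℝ) (ha : (a - x) * (a - y) * (a - z) = 0) : a ≤ 0 := by
    by_contra! hpos
    have h1 : (a - x) * (a - y) * (a - z) = a ^ 3 + 3 * a ^ 2 + b * a + c := by
      rw [hbe, hce, ← hz]
      linear_combination (a * x - a ^ 2) * hy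
    have : 0 < a ^ 3 + 3 * a ^ 2 + b * a + c := by positivity
    linarith
  have hx0 := hroot x (by ring)
  have hy0 := hroot y (by ring)
  have hz0 := hroot z (by ring)
  have h1 : x + y + z = -3 := by linarith
  have h2 : b = x * y + x * z + y * z := by rw [hbe, ← hz]; linear_combination (-x) * hy
  have h3 : c = -(x * y * z) := by rw [hce, ← hz]; ring
  rcases le_total x y with hxy | hxy
  · exact ⟨x, y, z, hxy, hyz, hz0, h1, h2, h3⟩
  · rcases le_total x z with hxz | hxz
    · exact ⟨y, x, z, hxy, hxz, hz0, by linarith, by simp only; linarith,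
        by simp only; linarith⟩
    · exact ⟨y, z, x, hyz, hxz, hx0, by linarith, by simp only; linarith,
        by simp only; linarith⟩

theorem region_eq : region = {u | 0 < u.1 ∧ 0 < u.2 ∧ 0 < dq u} := by
  ext u
  rw [mem_region_iff]
  constructor
  · rintro ⟨r, s, t, hrs, hst, ht, hu⟩
    have h1 := sub_pos.2 hrs
    have h2 := sub_pos.2 hst
    have h3 := sub_pos.2 (hrs.trans hst)
    have hr : 0 < -r := by linarith
    have hs : 0 < -s := by linarith
    have ht' : 0 < -t := by linarith
    refine ⟨?_, ?_, ?_⟩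
    · rw [hu.2.1]
      have : 0 < -r * -s + -r * -t + -s * -t := by positivity
      linarith
    · rw [hu.2.2]
      have : 0 < -r * -s * -t := by positivity
      linarith
    · rw [hu.dq_eq]; positivity
  · rintro ⟨hb, hc, hd⟩
    obtain ⟨r, s, t, hrs, hst, ht, hu⟩ := exists_sorted_hasRoots hb.le hc.le hd.le
    -- Equality of neighbouring roots annihilates `dq`, and t = 0 annihilates c.
    refine ⟨r, s, t, lt_of_le_of_ne hrs ?_, lt_of_le_of_ne hst ?_, lt_of_le_of_ne ht ?_, hu⟩
    · rintro rfl
      simp [hu.dq_eq] at hd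
    · rintro rfl
      simp [hu.dq_eq] at hd
    · rintro rfl
      simp [hu.2.2] at hc

theorem isOpen_region : IsOpen region := by
  rw [region_eq]
  have hdq : Continuous dq := by unfold dq; fun_prop
  exact (isOpen_lt continuous_const continuous_fst).inter
    ((isOpen_lt continuous_const continuous_snd).inter (isOpen_lt continuous_const hdq))

theorem isMorse_p_iff_of_mem_region {u : ℝ × ℝ} (hu : u ∈ region) :
    IsMorse (p u) ↔ g u ≠ 0 ∧ h u ≠ 0 := by
  obtain ⟨r, s, t, hrs, hst, ht, hu⟩ := mem_region_iff.1 hu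
  rw [isMorse_p_iff hrs hst ht hu, Ne, Ne, g_eq_zero_iff_eval hrs hst ht hu,
    h_eq_zero_iff_eval hrs hst ht hu]
  have h1 := eval_s_lt_eval_r hrs hst ht hu
  have h2 := eval_s_lt_eval_t hrs hst ht hu
  have h3 := eval_t_pos hrs hst ht hu
  generalize eval r (p u) = v₁ at *
  generalize eval s (p u) = v₂ at *
  generalize eval t (p u) = v₃ at *
  rcases pattern_cases h1 h2 h3 with h | h | h | h | h | h | h | h | h | h | h <;>
    grind

theorem isMorse_p_iff_of_pos {u : ℝ × ℝ} (hb : 0 < u.1) (hc : 0 < u.2) :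
    IsMorse (p u) ↔ u ∈ region ∧ g u ≠ 0 ∧ h u ≠ 0 := by
  suffices hreg : IsMorse (p u) → u ∈ region from
    ⟨fun h => ⟨hreg h, (isMorse_p_iff_of_mem_region (hreg h)).1 h⟩,
      fun h => (isMorse_p_iff_of_mem_region h.1).2 h.2⟩
  intro hM
  obtain ⟨x₁, x₂, x₃, x₄, h₁, h₂, h₃, hd⟩ := exists_derivative_eq (monic_p u) (natDegree_p u)
    (card_criticalPoints_of_isMorse (natDegree_p u) hM)
  have hx (x : ℝ) : x * (x ^ 3 + 3 * x ^ 2 + u.1 * x + u.2) =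
      (x - x₁) * (x - x₂) * (x - x₃) * (x - x₄) := by
    have := congrArg (eval x) ((derivative_p u).symm.trans hd)
    simp [eval_q] at this
    exact this
  have hpos (x : ℝ) (h0 : 0 < x) : (x - x₁) * (x - x₂) * (x - x₃) * (x - x₄) ≠ 0 := by
    rw [← hx]; positivity
  -- For b, c > 0 the product x·q(x) has no positive zero, yet it vanishes at 0; hence the largest
  -- critical point is 0 itself.
  have hle : x₄ ≤ 0 := not_lt.1 fun h => hpos x₄ h (by ring)
  obtain rfl : x₄ = 0 := by
    by_contra hne
    have h4 : x₄ < 0 := lt_of_le_of_ne hle hne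
    have h0 := hx 0
    have : 0 < -x₁ * -x₂ * -x₃ * -x₄ := by
      have := neg_pos.2 h4
      have := neg_pos.2 (h₃.trans h4)
      have := neg_pos.2 (h₂.trans (h₃.trans h4))
      have := neg_pos.2 (h₁.trans (h₂.trans (h₃.trans h4)))
      positivity
    linarith
  refine ⟨x₁, x₂, x₃, h₁, h₂, h₃, ?_⟩
  have hne : (C 5 * X : ℝ[X]) ≠ 0 := mul_ne_zero (by simp) X_ne_zero
  apply mul_left_cancel₀ hne
  rw [mul_assoc, ← derivative_p, hd, C_0]
  ring

/-! ### A chart of the closed triangle `OAB`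

A point `(l, w)` of the unit square is sent to the polynomial `q` whose roots `r ≤ s ≤ t` have the
gaps `s - r`, `t - s`, `-t` proportional to `(1 - l) * (1 - w)`, `w`, `l * (1 - w)`. -/

def openSquare : Set (ℝ × ℝ) := {x | 0 < x.1 ∧ x.1 < 1 ∧ 0 < x.2 ∧ x.2 < 1}

def closedSquare : Set (ℝ × ℝ) := {x | 0 ≤ x.1 ∧ x.1 ≤ 1 ∧ 0 ≤ x.2 ∧ x.2 ≤ 1}

theorem openSquare_subset : openSquare ⊆ closedSquare :=
  fun _ h => ⟨h.1.le, h.2.1.le, h.2.2.1.le, h.2.2.2.le⟩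

theorem isCompact_closedSquare : IsCompact closedSquare := by
  have : closedSquare = Set.Icc (0 : ℝ) 1 ×ˢ Set.Icc (0 : ℝ) 1 := by
    ext x; simp [closedSquare, Set.mem_prod, and_assoc, -Set.Icc_prod_Icc]
  rw [this]
  exact isCompact_Icc.prod isCompact_Icc

/-- This is the total length -r of the three gaps, forced by r + s + t = -3 once their proportions
are fixed. -/
noncomputable def chartScale (x : ℝ × ℝ) : ℝ := 3 / (1 + x.2 + 2 * x.1 * (1 - x.2))

noncomputable def chartR (x : ℝ × ℝ) : ℝ := -chartScale x

noncomputable def chartS (x : ℝ × ℝ) : ℝ := -(chartScale x * (x.2 + x.1 * (1 - x.2)))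

noncomputable def chartT (x : ℝ × ℝ) : ℝ := -(chartScale x * (x.1 * (1 - x.2)))

noncomputable def chart (x : ℝ × ℝ) : ℝ × ℝ :=
  (chartR x * chartS x + chartR x * chartT x + chartS x * chartT x,
    -(chartR x * chartS x * chartT x))

theorem chartScale_den_pos {x : ℝ × ℝ} (hx : x ∈ closedSquare) :
    0 < 1 + x.2 + 2 * x.1 * (1 - x.2) := by
  obtain ⟨h1, h2, h3, h4⟩ := hx
  nlinarith [mul_nonneg h1 (sub_nonneg.2 h4)]

theorem chartScale_pos {x : ℝ × ℝ} (hx : x ∈ closedSquare) : 0 < chartScale x :=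
  div_pos (by norm_num) (chartScale_den_pos hx)

theorem continuousOn_chart : ContinuousOn chart closedSquare := by
  have h : ContinuousOn chartScale closedSquare :=
    ContinuousOn.div (by fun_prop) (by fun_prop) fun x hx => (chartScale_den_pos hx).ne'
  unfold chart chartR chartS chartT
  fun_prop

theorem hasRoots_chart {x : ℝ × ℝ} (hx : x ∈ closedSquare) :
    HasRoots (chart x) (chartR x) (chartS x) (chartT x) := by
  refine ⟨?_, rfl, rfl⟩
  have := chartScale_den_pos hx
  simp only [chartR, chartS, chartT, chartScale]
  field_simp
  ring

theorem chartR_le_chartS {x : ℝ × ℝ} (hx : x ∈ closedSquare) : chartR x ≤ chartS x := by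
  have h := chartScale_pos hx
  obtain ⟨h1, h2, h3, h4⟩ := hx
  have : 0 ≤ chartScale x * ((1 - x.1) * (1 - x.2)) :=
    mul_nonneg h.le (mul_nonneg (by linarith) (by linarith))
  rw [chartR, chartS]; linarith

theorem chartS_le_chartT {x : ℝ × ℝ} (hx : x ∈ closedSquare) : chartS x ≤ chartT x := by
  have h := mul_nonneg (chartScale_pos hx).le hx.2.2.1
  rw [chartS, chartT]; linarith

theorem chartT_nonpos {x : ℝ × ℝ} (hx : x ∈ closedSquare) : chartT x ≤ 0 := by
  have : 0 ≤ chartScale x * (x.1 * (1 - x.2)) :=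
    mul_nonneg (chartScale_pos hx).le (mul_nonneg hx.1 (by linarith [hx.2.2.2]))
  rw [chartT]; linarith

theorem chartR_lt_chartS {x : ℝ × ℝ} (hx : x ∈ openSquare) : chartR x < chartS x := by
  have h := chartScale_pos (openSquare_subset hx)
  obtain ⟨h1, h2, h3, h4⟩ := hx
  have : 0 < chartScale x * ((1 - x.1) * (1 - x.2)) :=
    mul_pos h (mul_pos (by linarith) (by linarith))
  rw [chartR, chartS]; linarith

theorem chartS_lt_chartT {x : ℝ × ℝ} (hx : x ∈ openSquare) : chartS x < chartT x := by
  have h := mul_pos (chartScale_pos (openSquare_subset hx)) hx.2.2.1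
  rw [chartS, chartT]; linarith

theorem chartT_neg {x : ℝ × ℝ} (hx : x ∈ openSquare) : chartT x < 0 := by
  have : 0 < chartScale x * (x.1 * (1 - x.2)) :=
    mul_pos (chartScale_pos (openSquare_subset hx)) (mul_pos hx.1 (by linarith [hx.2.2.2]))
  rw [chartT]; linarith

/-- The root set determines its least and greatest elements, and the sum then determines the middle
root, also when roots coincide. -/
theorem HasRoots.unique {u : ℝ × ℝ} {r s t r' s' t' : ℝ} (h : HasRoots u r s t)
    (h' : HasRoots u r' s' t') (hrs : r ≤ s) (hst : s ≤ t) (hrs' : r' ≤ s') (hst' : s' ≤ t') :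
    r = r' ∧ s = s' ∧ t = t' := by
  have hroot (x : ℝ) : (x = r ∨ x = s ∨ x = t) ↔ (x = r' ∨ x = s' ∨ x = t') := by
    rw [← h.isRoot_iff, ← h'.isRoot_iff]
  have ht : t = t' := by
    apply le_antisymm
    · rcases (hroot t).1 (by simp) with h | h | h <;> linarith
    · rcases (hroot t').2 (by simp) with h | h | h <;> linarith
  have hr : r = r' := by
    apply le_antisymm
    · rcases (hroot r').2 (by simp) with h | h | h <;> linarith
    · rcases (hroot r).1 (by simp) with h | h | h <;> linarith
  exact ⟨hr, by linarith [h.1, h'.1], ht⟩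

/-- The coefficients determine the sorted roots: -r gives the scale, t - s gives w, and -t gives l
unless w = 1. The top edge is the only place where injectivity fails. -/
theorem chart_eq_chart {x y : ℝ × ℝ} (hx : x ∈ closedSquare) (hy : y ∈ closedSquare)
    (h : chart x = chart y) : x = y ∨ (x.2 = 1 ∧ y.2 = 1) := by
  obtain ⟨hr, hs, ht⟩ := (hasRoots_chart hx).unique (h ▸ hasRoots_chart hy)
    (chartR_le_chartS hx) (chartS_le_chartT hx) (chartR_le_chartS hy) (chartS_le_chartT hy)
  have hpos := (chartScale_pos hy).ne'
  have hk : chartScale x = chartScale y := neg_injective hr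
  rw [chartS, chartS, hk, neg_inj] at hs
  rw [chartT, chartT, hk, neg_inj] at ht
  have hs := mul_left_cancel₀ hpos hs
  have ht := mul_left_cancel₀ hpos ht
  have hw : x.2 = y.2 := by linarith
  rcases eq_or_ne y.2 1 with h1 | h1
  · exact Or.inr ⟨hw.trans h1, h1⟩
  · left
    rw [hw] at ht
    exact Prod.ext (mul_right_cancel₀ (sub_ne_zero.2 h1.symm) ht) hw

theorem chart_injOn : Set.InjOn chart {x ∈ closedSquare | x.2 < 1} := fun x hx y hy h => by
  rcases chart_eq_chart hx.1 hy.1 h with h | h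
  · exact h
  · exact absurd h.1 hx.2.ne

theorem exists_chart_eq {u : ℝ × ℝ} {r s t : ℝ} (hrs : r ≤ s) (hst : s ≤ t) (ht : t ≤ 0)
    (hu : HasRoots u r s t) :
    ∃ x ∈ closedSquare, chart x = u ∧ chartR x = r ∧ chartS x = s ∧ chartT x = t := by
  suffices H : ∃ x ∈ closedSquare, chartR x = r ∧ chartS x = s ∧ chartT x = t by
    obtain ⟨x, hx, h1, h2, h3⟩ := H
    refine ⟨x, hx, Prod.ext ?_ ?_, h1, h2, h3⟩
    · rw [hu.2.1, chart, h1, h2, h3]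
    · rw [hu.2.2, chart, h1, h2, h3]
  have hsum := hu.1
  have hr : 0 < -r := by linarith
  have hr0 : r ≠ 0 := by linarith
  -- If both outer gaps vanish then w = 1 and l is arbitrary; this is the vertex B, and l = 0 is
  -- chosen. Otherwise l is the share of -t in the two outer gaps, and w the share of t - s in all
  -- three.
  rcases eq_or_ne ((s - r) + -t) 0 with h0 | h0
  · have hs : s = r := by linarith
    have ht0 : t = 0 := by linarith
    have hrv : r = -3 / 2 := by linarith
    refine ⟨(0, 1), by simp [closedSquare], ?_⟩
    rw [hs, ht0, hrv]
    norm_num [chartR, chartS, chartT, chartScale]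
  · have hpos : 0 < s - r - t := lt_of_le_of_ne (by linarith) (by intro h; apply h0; linarith)
    have hw : 1 - (t - s) / (-r) = (s - r - t) / (-r) := by field_simp; ring
    have hl : (-t) / (s - r - t) * ((s - r - t) / (-r)) = t / r := by field_simp
    have hk : chartScale ((-t) / (s - r - t), (t - s) / (-r)) = -r := by
      simp only [chartScale]
      rw [mul_assoc, hw, hl]
      have h3 : 1 + (t - s) / -r + 2 * (t / r) = 3 / (-r) := by
        field_simp; linarith
      rw [h3]; field_simp
    refine ⟨((-t) / (s - r - t), (t - s) / (-r)), ⟨?_, ?_, ?_, ?_⟩, ?_, ?_, ?_⟩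
    · exact div_nonneg (by linarith) hpos.le
    · rw [div_le_one hpos]; linarith
    · exact div_nonneg (by linarith) hr.le
    · rw [div_le_one hr]; linarith
    · rw [chartR, hk, neg_neg]
    · rw [chartS, hk, hw, hl]; field_simp; ring
    · rw [chartT, hk, hw, hl]; field_simp

theorem region_eq_image : region = chart '' openSquare := by
  ext u
  rw [mem_region_iff]
  constructor
  · rintro ⟨r, s, t, hrs, hst, ht, hu⟩
    obtain ⟨x, hx, rfl, rfl, rfl, rfl⟩ := exists_chart_eq hrs.le hst.le ht.le hu
    refine ⟨x, ?_, rfl⟩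
    have hk := chartScale_pos hx
    obtain ⟨h1, h2, h3, h4⟩ := hx
    rw [chartR, chartS] at hrs
    rw [chartS, chartT] at hst
    rw [chartT] at ht
    refine ⟨lt_of_le_of_ne h1 ?_, lt_of_le_of_ne h2 ?_, lt_of_le_of_ne h3 ?_,
      lt_of_le_of_ne h4 ?_⟩
    · intro h; rw [← h] at ht; simp at ht
    · intro h; rw [h] at hrs; linarith
    · intro h; rw [← h] at hst; linarith
    · intro h; rw [h] at hrs; linarith
  · rintro ⟨x, hx, rfl⟩
    exact ⟨_, _, _, chartR_lt_chartS hx, chartS_lt_chartT hx, chartT_neg hx,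
      hasRoots_chart (openSquare_subset hx)⟩

/-! ### The curves in the chart -/

/-- The zero in `[0, 1)` of the quadratic
`-2 * w ^ 2 + m * (w * (1 - w)) + n * (1 - w) ^ 2` in `w`. -/
noncomputable def threshold (m n : ℝ) : ℝ :=
  (m + √(m ^ 2 + 8 * n)) / (4 + (m + √(m ^ 2 + 8 * n)))

section Threshold

variable {m n : ℝ}

theorem threshold_num_nonneg (hn : 0 ≤ n) : 0 ≤ m + √(m ^ 2 + 8 * n) := by
  have h : |m| ≤ √(m ^ 2 + 8 * n) := Real.abs_le_sqrt (by linarith)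
  linarith [neg_abs_le m]

theorem threshold_nonneg (hn : 0 ≤ n) : 0 ≤ threshold m n :=
  div_nonneg (threshold_num_nonneg hn) (by linarith [threshold_num_nonneg (m := m) hn])

theorem threshold_lt_one (hn : 0 ≤ n) : threshold m n < 1 := by
  have := threshold_num_nonneg (m := m) hn
  rw [threshold, div_lt_one (by linarith)]
  linarith

/-- In y = w/(1 - w) the quadratic is -2y² + my + n, with roots (m ± √(m² + 8n))/4. The assumption
`hmn` makes the lower root strictly negative, so on the whole of [0, 1] the sign is that of
`threshold m n - w`. -/
theorem exists_quadratic_eq (hn : 0 ≤ n) (hmn : 0 < n ∨ m < 0) {w : ℝ} (h0 : 0 ≤ w)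
    (h1 : w ≤ 1) : ∃ K > 0,
      -2 * w ^ 2 + m * (w * (1 - w)) + n * (1 - w) ^ 2 = K * (threshold m n - w) := by
  have hnum := threshold_num_nonneg (m := m) hn
  have hsq := Real.sq_sqrt (show 0 ≤ m ^ 2 + 8 * n by positivity)
  have hnn := Real.sqrt_nonneg (m ^ 2 + 8 * n)
  have hlt : m < √(m ^ 2 + 8 * n) := by
    rcases hmn with h | h
    · exact Real.lt_sqrt_of_sq_lt (by linarith)
    · linarith
  rw [threshold]
  generalize √(m ^ 2 + 8 * n) = d at *
  -- The last factor of K is the linear factor belonging to the negative root, cleared of the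
  -- denominator 1 - w.
  refine ⟨(4 + (m + d)) / 2 * (w + (d - m) / 4 * (1 - w)), ?_, ?_⟩
  · apply mul_pos (by linarith)
    rcases eq_or_lt_of_le h0 with rfl | h
    · nlinarith
    · have : 0 ≤ (d - m) / 4 * (1 - w) := mul_nonneg (by linarith) (by linarith)
      linarith
  · have : (4 + (m + d)) ≠ 0 := by linarith
    field_simp
    linear_combination (-(1 - w) ^ 2) * hsq

end Threshold

/-- The curve of equal values at `r` and `t`, as a graph over the first coordinate. -/
noncomputable def curveRT (l : ℝ) : ℝ := threshold (1 - 6 * l) ((1 - l) * (3 + 2 * l))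

/-- The curve of zero value at `s`. -/
noncomputable def curveS (l : ℝ) : ℝ := curveRT (1 - l)

/-- The curve of zero value at `r`. -/
noncomputable def curveR (l : ℝ) : ℝ := threshold 1 (3 - 10 * l * (1 - l))

section Curves

variable {l w : ℝ}

theorem curveRT_nonneg (h0 : 0 ≤ l) (h1 : l ≤ 1) : 0 ≤ curveRT l :=
  threshold_nonneg (mul_nonneg (by linarith) (by linarith))

theorem curveRT_lt_one (h0 : 0 ≤ l) (h1 : l ≤ 1) : curveRT l < 1 :=
  threshold_lt_one (mul_nonneg (by linarith) (by linarith))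

theorem curveS_nonneg (h0 : 0 ≤ l) (h1 : l ≤ 1) : 0 ≤ curveS l :=
  curveRT_nonneg (by linarith) (by linarith)

theorem curveS_lt_one (h0 : 0 ≤ l) (h1 : l ≤ 1) : curveS l < 1 :=
  curveRT_lt_one (by linarith) (by linarith)

theorem curveR_aux_pos (l : ℝ) : 0 < 3 - 10 * l * (1 - l) := by
  nlinarith [sq_nonneg (2 * l - 1)]

theorem curveR_nonneg : 0 ≤ curveR l := threshold_nonneg (curveR_aux_pos l).le

theorem curveR_lt_one : curveR l < 1 := threshold_lt_one (curveR_aux_pos l).le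

theorem exists_curveRT_eq (h0 : 0 ≤ l) (h1 : l ≤ 1) (hw0 : 0 ≤ w) (hw1 : w ≤ 1) : ∃ K > 0,
    -2 * w ^ 2 + (1 - 6 * l) * (w * (1 - w)) + (1 - l) * (3 + 2 * l) * (1 - w) ^ 2 =
      K * (curveRT l - w) := by
  refine exists_quadratic_eq (mul_nonneg (by linarith) (by linarith)) ?_ hw0 hw1
  rcases eq_or_lt_of_le h1 with rfl | h
  · right; norm_num
  · left; exact mul_pos (by linarith) (by linarith)

/-- Reversing the order of the four critical points exchanges the outer gaps, that is l with 1 - l,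
and the pair (r, t) with (0, s). Hence this case follows from that of `curveRT`. -/
theorem exists_curveS_eq (h0 : 0 ≤ l) (h1 : l ≤ 1) (hw0 : 0 ≤ w) (hw1 : w ≤ 1) : ∃ K > 0,
    -2 * w ^ 2 + (6 * l - 5) * (w * (1 - w)) + l * (5 - 2 * l) * (1 - w) ^ 2 =
      K * (curveS l - w) := by
  obtain ⟨K, hK, h⟩ := exists_curveRT_eq (l := 1 - l) (by linarith) (by linarith) hw0 hw1
  exact ⟨K, hK, by rw [curveS, ← h]; ring⟩

theorem exists_curveR_eq (hw0 : 0 ≤ w) (hw1 : w ≤ 1) : ∃ K > 0,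
    -2 * w ^ 2 + w * (1 - w) + (3 - 10 * l * (1 - l)) * (1 - w) ^ 2 = K * (curveR l - w) := by
  obtain ⟨K, hK, h⟩ := exists_quadratic_eq (m := 1) (curveR_aux_pos l).le
    (Or.inl (curveR_aux_pos l)) hw0 hw1
  exact ⟨K, hK, by rw [curveR, ← h]; ring⟩

theorem continuousOn_curveRT : ContinuousOn curveRT (Set.Icc 0 1) := by
  unfold curveRT threshold
  refine ContinuousOn.div (by fun_prop) (by fun_prop) fun l hl => ?_
  have := threshold_num_nonneg (m := 1 - 6 * l) (n := (1 - l) * (3 + 2 * l))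
    (mul_nonneg (by linarith [hl.2]) (by linarith [hl.1]))
  linarith

theorem continuousOn_curveS : ContinuousOn curveS (Set.Icc 0 1) :=
  continuousOn_curveRT.comp (by fun_prop) fun l hl => ⟨by linarith [hl.2], by linarith [hl.1]⟩

theorem continuousOn_curveR : ContinuousOn curveR (Set.Icc 0 1) := by
  unfold curveR threshold
  refine ContinuousOn.div (by fun_prop) (by fun_prop) fun l hl => ?_
  have := threshold_num_nonneg (m := 1) (curveR_aux_pos l).le
  linarith

theorem threshold_one_three : threshold 1 3 = 3 / 5 := by
  have : √((1 : ℝ) ^ 2 + 8 * 3) = 5 := by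
    rw [show (1 : ℝ) ^ 2 + 8 * 3 = 5 ^ 2 by norm_num]; exact Real.sqrt_sq (by norm_num)
  rw [threshold, this]; norm_num

theorem curveRT_zero : curveRT 0 = 3 / 5 := by
  rw [curveRT, ← threshold_one_three]; norm_num

theorem curveRT_one : curveRT 1 = 0 := by
  have : √((-5 : ℝ) ^ 2) = 5 := by rw [Real.sqrt_sq_eq_abs]; norm_num
  rw [curveRT, threshold]
  norm_num

theorem curveS_zero : curveS 0 = 0 := by rw [curveS, sub_zero, curveRT_one]

theorem curveS_one : curveS 1 = 3 / 5 := by rw [curveS, sub_self, curveRT_zero]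

theorem curveR_zero : curveR 0 = 3 / 5 := by
  rw [curveR, ← threshold_one_three]; norm_num

theorem curveR_one : curveR 1 = 3 / 5 := by
  rw [curveR, ← threshold_one_three]; norm_num

theorem curveS_half : curveS (1 / 2) = curveRT (1 / 2) := by rw [curveS]; norm_num

theorem curveR_symm (l : ℝ) : curveR (1 - l) = curveR l := by
  rw [curveR, curveR]; congr 1; ring

/-- The quadratic of `curveS` minus that of `curveRT` is -3(1 - 2l)(1 - w²), negative for l < 1/2.
Evaluating it on `curveRT` places that point above `curveS`. -/
theorem curveS_lt_curveRT (h0 : 0 ≤ l) (h1 : l < 1 / 2) : curveS l < curveRT l := by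
  have hw0 := curveRT_nonneg h0 (by linarith)
  have hw1 := curveRT_lt_one h0 (by linarith)
  obtain ⟨K, hK, h⟩ := exists_curveRT_eq h0 (by linarith) hw0 hw1.le
  obtain ⟨K', hK', h'⟩ := exists_curveS_eq h0 (by linarith) hw0 hw1.le
  rw [sub_self, mul_zero] at h
  generalize curveRT l = w at *
  have : 0 < 3 * (1 - 2 * l) * ((1 - w) * (1 + w)) :=
    mul_pos (by linarith) (mul_pos (by linarith) (by linarith))
  have : K' * (curveS l - w) < 0 := by rw [← h']; linarith
  linarith [neg_of_mul_neg_right this hK'.le]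

theorem curveRT_lt_curveS (h0 : 1 / 2 < l) (h1 : l ≤ 1) : curveRT l < curveS l := by
  have := curveS_lt_curveRT (l := 1 - l) (by linarith) (by linarith)
  rwa [curveS, sub_sub_cancel] at this

theorem curveRT_pos (h0 : 0 ≤ l) (h1 : l < 1) : 0 < curveRT l := by
  obtain ⟨K, hK, h⟩ := exists_curveRT_eq (w := 0) h0 h1.le le_rfl zero_le_one
  have : 0 < K * (curveRT l - 0) := by
    rw [← h]
    have : 0 < (1 - l) * (3 + 2 * l) := mul_pos (by linarith) (by linarith)
    linarith
  linarith [pos_of_mul_pos_right this hK.le]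

theorem curveS_pos (h0 : 0 < l) (h1 : l ≤ 1) : 0 < curveS l :=
  curveRT_pos (by linarith) (by linarith)

/-- With normalised gaps a = (1 - l)(1 - w), w, c = l(1 - w), the quadratic of `curveR` exceeds that
of `curveRT` by 3c(c + 2w - 3a). So it suffices that 3a < c + 2w on `curveRT`. -/
theorem curveRT_lt_curveR (h0 : 0 < l) (h1 : l ≤ 1) : curveRT l < curveR l := by
  have hw0 := curveRT_nonneg h0.le h1
  have hw1 := curveRT_lt_one h0.le h1
  obtain ⟨K, hK, h⟩ := exists_curveRT_eq h0.le h1 hw0 hw1.le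
  obtain ⟨K', hK', h'⟩ := exists_curveR_eq (l := l) hw0 hw1.le
  rw [sub_self, mul_zero] at h
  generalize curveRT l = w at *
  have hc : 0 < l * (1 - w) := mul_pos h0 (by linarith)
  have key : 3 * ((1 - l) * (1 - w)) < l * (1 - w) + 2 * w := by
    -- If 3a - 2w ≥ c, the equation `e1` of `curveRT` would give 0 ≥ c(a + w) + 5c(a - w) = 2c(3a -
    -- 2w) ≥ 2c² > 0.
    by_contra! hcon
    have ha : 0 ≤ (1 - l) * (1 - w) := mul_nonneg (by linarith) (by linarith)
    have e1 : (3 * ((1 - l) * (1 - w)) - 2 * w) * ((1 - l) * (1 - w) + w) +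
        5 * (l * (1 - w)) * ((1 - l) * (1 - w) - w) = 0 := by rw [← h]; ring
    generalize (1 - l) * (1 - w) = a at *
    generalize l * (1 - w) = c at *
    nlinarith [mul_nonneg (sub_nonneg.2 hcon) (add_nonneg ha hw0),
      mul_nonneg hc.le (sub_nonneg.2 hcon), mul_pos hc hc]
  have : 0 < K' * (curveR l - w) := by
    rw [← h']
    have := mul_pos (mul_pos three_pos hc) (sub_pos.2 key)
    linarith
  linarith [pos_of_mul_pos_right this hK'.le]

theorem curveS_lt_curveR (h0 : 0 ≤ l) (h1 : l < 1) : curveS l < curveR l := by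
  rw [← curveR_symm]
  exact curveRT_lt_curveR (by linarith) (by linarith)

end Curves

/-! ### Critical values in the chart -/

section CriticalValues

variable {x : ℝ × ℝ}

/-- Homogeneity in the gaps makes the conic equal to `2 * chartScale x ^ 2` times the quadratic in
w, so the sign of the difference is the position relative to the graph. The next two lemmas do this
for `curveS` and `curveR`. -/
theorem exists_eval_chartR_sub_chartT (hx : x ∈ openSquare) : ∃ K > 0,
    (p (chart x)).eval (chartR x) - (p (chart x)).eval (chartT x) = K * (curveRT x.1 - x.2) := by
  have hx' := openSquare_subset hx
  obtain ⟨K, hK, h⟩ := exists_curveRT_eq hx'.1 hx'.2.1 hx'.2.2.1 hx'.2.2.2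
  have hk := chartScale_pos hx'
  have hd : 0 < chartT x - chartR x :=
    sub_pos.2 ((chartR_lt_chartS hx).trans (chartS_lt_chartT hx))
  refine ⟨(chartT x - chartR x) ^ 3 / 24 * (2 * chartScale x ^ 2 * K), by positivity, ?_⟩
  rw [(hasRoots_chart hx').eval_sub_rt, mul_assoc, mul_assoc (2 * _), ← h]
  congr 1
  rw [conic, chartR, chartS, chartT]
  ring

theorem exists_eval_chartS (hx : x ∈ openSquare) : ∃ K > 0,
    (p (chart x)).eval (chartS x) = K * (curveS x.1 - x.2) := by
  have hx' := openSquare_subset hx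
  obtain ⟨K, hK, h⟩ := exists_curveS_eq hx'.1 hx'.2.1 hx'.2.2.1 hx'.2.2.2
  have hk := chartScale_pos hx'
  have hd : 0 < -chartS x := neg_pos.2 ((chartS_lt_chartT hx).trans (chartT_neg hx))
  refine ⟨(-chartS x) ^ 3 / 24 * (2 * chartScale x ^ 2 * K), by positivity, ?_⟩
  rw [(hasRoots_chart hx').eval_s, mul_assoc, mul_assoc (2 * _), ← h]
  congr 1
  rw [conic, chartR, chartS, chartT]
  ring

theorem exists_eval_chartR (hx : x ∈ openSquare) : ∃ K > 0,
    (p (chart x)).eval (chartR x) = K * (curveR x.1 - x.2) := by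
  have hx' := openSquare_subset hx
  obtain ⟨K, hK, h⟩ := exists_curveR_eq (l := x.1) hx'.2.2.1 hx'.2.2.2
  have hk := chartScale_pos hx'
  have hd : 0 < -chartR x := neg_pos.2
    ((chartR_lt_chartS hx).trans ((chartS_lt_chartT hx).trans (chartT_neg hx)))
  refine ⟨(-chartR x) ^ 3 / 24 * (2 * chartScale x ^ 2 * K), by positivity, ?_⟩
  rw [(hasRoots_chart hx').eval_r, mul_assoc, mul_assoc (2 * _), ← h]
  congr 1
  rw [conic, chartR, chartS, chartT]
  ring

end CriticalValues

/-! ### Cells and arcs in the chart -/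

def cell (a b : ℝ) (f g : ℝ → ℝ) : Set (ℝ × ℝ) :=
  {x | a < x.1 ∧ x.1 < b ∧ f x.1 < x.2 ∧ x.2 < g x.1}

def closedCell (a b : ℝ) (f g : ℝ → ℝ) : Set (ℝ × ℝ) :=
  {x | a ≤ x.1 ∧ x.1 ≤ b ∧ f x.1 ≤ x.2 ∧ x.2 ≤ g x.1}

def graphArc (f : ℝ → ℝ) (a b : ℝ) : Set (ℝ × ℝ) := {x | a ≤ x.1 ∧ x.1 ≤ b ∧ x.2 = f x.1}

def verticalArc (l a b : ℝ) : Set (ℝ × ℝ) := {x | x.1 = l ∧ a ≤ x.2 ∧ x.2 ≤ b}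

/-- Two distinct points share an image only if both lie on the top edge, so it is enough that one of
the two sets avoids it. -/
theorem image_chart_inter {S T : Set (ℝ × ℝ)} (hS : S ⊆ closedSquare) (hT : T ⊆ closedSquare)
    (h1 : ∀ x ∈ S, x.2 < 1) : chart '' S ∩ chart '' T = chart '' (S ∩ T) := by
  refine Set.Subset.antisymm ?_ (Set.image_inter_subset _ _ _)
  rintro u ⟨⟨x, hx, rfl⟩, y, hy, hxy⟩
  rcases chart_eq_chart (hT hy) (hS hx) hxy with h | h
  · exact ⟨x, ⟨hx, h ▸ hy⟩, rfl⟩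
  · exact absurd h.2 (h1 x hx).ne

theorem image_chart_diff {S T : Set (ℝ × ℝ)} (hS : S ⊆ closedSquare) (hT : T ⊆ closedSquare)
    (h1 : ∀ x ∈ T, x.2 < 1) : chart '' S \ chart '' T = chart '' (S \ T) := by
  refine Set.Subset.antisymm ?_ ?_
  · rintro u ⟨⟨x, hx, rfl⟩, hn⟩
    exact ⟨x, ⟨hx, fun h => hn ⟨x, h, rfl⟩⟩, rfl⟩
  rintro u ⟨x, ⟨hx, hxT⟩, rfl⟩
  refine ⟨⟨x, hx, rfl⟩, ?_⟩
  rintro ⟨y, hy, hxy⟩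
  rcases chart_eq_chart (hT hy) (hS hx) hxy with h | h
  · exact hxT (h ▸ hy)
  · exact absurd h.1 (h1 y hy).ne

section Cell

variable {a b : ℝ} {f g : ℝ → ℝ}

/-- The parametrisation of a cell by a rectangle. -/
def cellMap (f g : ℝ → ℝ) (y : ℝ × ℝ) : ℝ × ℝ := (y.1, (1 - y.2) * f y.1 + y.2 * g y.1)

theorem continuousOn_cellMap (hf : ContinuousOn f (Set.Icc a b))
    (hg : ContinuousOn g (Set.Icc a b)) :
    ContinuousOn (cellMap f g) (Set.Icc a b ×ˢ Set.Icc 0 1) := by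
  have hf' : ContinuousOn (fun y : ℝ × ℝ => f y.1) (Set.Icc a b ×ˢ Set.Icc 0 1) :=
    hf.comp continuousOn_fst fun y hy => hy.1
  have hg' : ContinuousOn (fun y : ℝ × ℝ => g y.1) (Set.Icc a b ×ˢ Set.Icc 0 1) :=
    hg.comp continuousOn_fst fun y hy => hy.1
  exact continuousOn_fst.prodMk
    (((continuousOn_const.sub continuousOn_snd).mul hf').add (continuousOn_snd.mul hg'))

theorem image_cellMap_Ioo (hlt : ∀ l ∈ Set.Ioo a b, f l < g l) :
    cellMap f g '' (Set.Ioo a b ×ˢ Set.Ioo 0 1) = cell a b f g := by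
  ext x
  constructor
  · rintro ⟨⟨l, y⟩, ⟨hl, hy0, hy1⟩, rfl⟩
    have := hlt l hl
    simp only at hy0 hy1
    refine ⟨hl.1, hl.2, ?_, ?_⟩ <;> simp only [cellMap] <;> nlinarith
  · rintro ⟨h1, h2, h3, h4⟩
    have h5 := sub_pos.2 (hlt x.1 ⟨h1, h2⟩)
    refine ⟨(x.1, (x.2 - f x.1) / (g x.1 - f x.1)), ⟨⟨h1, h2⟩, ?_, ?_⟩, Prod.ext rfl ?_⟩
    · exact div_pos (by linarith) h5
    · simp only; rw [div_lt_one h5]; linarith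
    · simp only [cellMap]; field_simp; ring

theorem image_cellMap_Icc (hle : ∀ l ∈ Set.Icc a b, f l ≤ g l) :
    cellMap f g '' (Set.Icc a b ×ˢ Set.Icc 0 1) = closedCell a b f g := by
  ext x
  constructor
  · rintro ⟨⟨l, y⟩, ⟨hl, hy0, hy1⟩, rfl⟩
    have := hle l hl
    simp only at hy0 hy1
    refine ⟨hl.1, hl.2, ?_, ?_⟩ <;> simp only [cellMap] <;> nlinarith
  · rintro ⟨h1, h2, h3, h4⟩
    rcases eq_or_lt_of_le (hle x.1 ⟨h1, h2⟩) with h | h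
    · refine ⟨(x.1, 0), ⟨⟨h1, h2⟩, by simp⟩, Prod.ext rfl ?_⟩
      simp only [cellMap]; linarith
    · have h5 := sub_pos.2 h
      refine ⟨(x.1, (x.2 - f x.1) / (g x.1 - f x.1)), ⟨⟨h1, h2⟩, ?_, ?_⟩, Prod.ext rfl ?_⟩
      · exact div_nonneg (by linarith) h5.le
      · simp only; rw [div_le_one h5]; linarith
      · simp only [cellMap]; field_simp; ring

theorem isOpen_cell (hf : ContinuousOn f (Set.Icc a b)) (hg : ContinuousOn g (Set.Icc a b)) :
    IsOpen (cell a b f g) := by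
  have hU : IsOpen (Prod.fst ⁻¹' Set.Ioo a b : Set (ℝ × ℝ)) := isOpen_Ioo.preimage continuous_fst
  have hmaps : Set.MapsTo Prod.fst (Prod.fst ⁻¹' Set.Ioo a b : Set (ℝ × ℝ)) (Set.Icc a b) :=
    fun x hx => Set.Ioo_subset_Icc_self hx
  have hf' : ContinuousOn (fun x : ℝ × ℝ => x.2 - f x.1) (Prod.fst ⁻¹' Set.Ioo a b) :=
    continuousOn_snd.sub (hf.comp continuousOn_fst hmaps)
  have hg' : ContinuousOn (fun x : ℝ × ℝ => g x.1 - x.2) (Prod.fst ⁻¹' Set.Ioo a b) :=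
    (hg.comp continuousOn_fst hmaps).sub continuousOn_snd
  have h := (hf'.isOpen_inter_preimage hU (isOpen_Ioi (a := (0 : ℝ)))).inter
    (hg'.isOpen_inter_preimage hU (isOpen_Ioi (a := (0 : ℝ))))
  convert h using 1
  ext x
  simp only [cell, Set.mem_inter_iff, Set.mem_preimage, Set.mem_Ioo, Set.mem_Ioi, sub_pos,
    Set.mem_ofPred_eq]
  tauto

/-- The conditions under which `cell a b f g` is a domain in the open unit square. -/
structure IsCell (a b : ℝ) (f g : ℝ → ℝ) : Prop where
  left : 0 ≤ a
  lt : a < b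
  right : b ≤ 1
  cont_lower : ContinuousOn f (Set.Icc a b)
  cont_upper : ContinuousOn g (Set.Icc a b)
  nonneg : ∀ l ∈ Set.Icc a b, 0 ≤ f l
  le : ∀ l ∈ Set.Icc a b, f l ≤ g l
  le_one : ∀ l ∈ Set.Icc a b, g l ≤ 1
  lt_of_mem : ∀ l ∈ Set.Ioo a b, f l < g l

theorem IsCell.cell_subset (hc : IsCell a b f g) : cell a b f g ⊆ openSquare := by
  rintro x ⟨h1, h2, h3, h4⟩
  have hm : x.1 ∈ Set.Icc a b := ⟨h1.le, h2.le⟩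
  exact ⟨hc.left.trans_lt h1, h2.trans_le hc.right, (hc.nonneg _ hm).trans_lt h3,
    h4.trans_le (hc.le_one _ hm)⟩

theorem IsCell.closedCell_subset (hc : IsCell a b f g) : closedCell a b f g ⊆ closedSquare := by
  rintro x ⟨h1, h2, h3, h4⟩
  have hm : x.1 ∈ Set.Icc a b := ⟨h1, h2⟩
  exact ⟨hc.left.trans h1, h2.trans hc.right, (hc.nonneg _ hm).trans h3,
    h4.trans (hc.le_one _ hm)⟩

/-- The image is the open set `region` minus the image of the rest of the square; that rest is
compact, so its image is closed. This replaces any appeal to invariance of domain. -/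
theorem IsCell.isOpen_image (hc : IsCell a b f g) : IsOpen (chart '' cell a b f g) := by
  have hcell := hc.cell_subset
  have hK : IsCompact (chart '' (closedSquare \ cell a b f g)) :=
    (isCompact_closedSquare.diff (isOpen_cell hc.cont_lower hc.cont_upper)).image_of_continuousOn
      (continuousOn_chart.mono Set.sdiff_subset)
  have h : chart '' cell a b f g = region \ chart '' (closedSquare \ cell a b f g) := by
    ext u
    constructor
    · rintro ⟨x, hx, rfl⟩
      refine ⟨region_eq_image ▸ Set.mem_image_of_mem _ (hcell hx), ?_⟩
      rintro ⟨y, hy, hxy⟩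
      rcases chart_eq_chart hy.1 (openSquare_subset (hcell hx)) hxy with h | h
      · exact hy.2 (h ▸ hx)
      · exact absurd h.2 (hcell hx).2.2.2.ne
    · rintro ⟨hu, hnot⟩
      rw [region_eq_image] at hu
      obtain ⟨x, hx, rfl⟩ := hu
      by_contra hcon
      exact hnot ⟨x, ⟨openSquare_subset hx, fun h => hcon ⟨x, h, rfl⟩⟩, rfl⟩
  rw [h]
  exact isOpen_region.sdiff hK.isClosed

theorem IsCell.isConnected_image (hc : IsCell a b f g) :
    IsConnected (chart '' cell a b f g) := by
  have h : IsConnected (cell a b f g) := by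
    rw [← image_cellMap_Ioo hc.lt_of_mem]
    refine ((isConnected_Ioo hc.lt).prod (isConnected_Ioo zero_lt_one)).image _ ?_
    exact (continuousOn_cellMap hc.cont_lower hc.cont_upper).mono
      (Set.prod_mono Set.Ioo_subset_Icc_self Set.Ioo_subset_Icc_self)
  exact h.image _ (continuousOn_chart.mono (hc.cell_subset.trans openSquare_subset))

theorem isBounded_image_chart {S : Set (ℝ × ℝ)} (hS : S ⊆ closedSquare) :
    Bornology.IsBounded (chart '' S) :=
  (isCompact_closedSquare.image_of_continuousOn continuousOn_chart).isBounded.subset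
    (Set.image_mono hS)

/-- The closed cell is compact, which bounds the closure from above. Conversely, the parametrisation
by a rectangle is continuous up to the boundary, and the closed rectangle is the closure of the open
one. -/
theorem IsCell.closure_image (hc : IsCell a b f g) :
    closure (chart '' cell a b f g) = chart '' closedCell a b f g := by
  have hcm := continuousOn_cellMap hc.cont_lower hc.cont_upper
  have hK : IsCompact (closedCell a b f g) := by
    rw [← image_cellMap_Icc hc.le]
    exact (isCompact_Icc.prod isCompact_Icc).image_of_continuousOn hcm
  have hcc : ContinuousOn chart (closedCell a b f g) :=
    continuousOn_chart.mono hc.closedCell_subset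
  refine Set.Subset.antisymm ?_ ?_
  · refine closure_minimal (Set.image_mono ?_) (hK.image_of_continuousOn hcc).isClosed
    exact fun x hx => ⟨hx.1.le, hx.2.1.le, hx.2.2.1.le, hx.2.2.2.le⟩
  · have hcl : closure (Set.Ioo a b ×ˢ Set.Ioo (0 : ℝ) 1) = Set.Icc a b ×ˢ Set.Icc 0 1 := by
      rw [closure_prod_eq, closure_Ioo hc.lt.ne, closure_Ioo zero_ne_one]
    have hmaps : Set.MapsTo (cellMap f g) (Set.Icc a b ×ˢ Set.Icc 0 1) (closedCell a b f g) := by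
      rw [← image_cellMap_Icc hc.le]; exact Set.mapsTo_image _ _
    have hcomp := hcc.comp hcm hmaps
    rw [← image_cellMap_Icc hc.le, ← image_cellMap_Ioo hc.lt_of_mem, ← Set.image_comp,
      ← Set.image_comp, ← hcl]
    rw [← hcl] at hcomp
    exact hcomp.image_closure

/-- The vertical sides may degenerate to points where f and g meet, and a side on the top edge
collapses under `chart`; this is how four-sided cells become triangles. -/
theorem IsCell.frontier_image (hc : IsCell a b f g) :
    frontier (chart '' cell a b f g) = chart '' graphArc f a b ∪ chart '' graphArc g a b ∪
      chart '' verticalArc a (f a) (g a) ∪ chart '' verticalArc b (f b) (g b) := by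
  rw [frontier, hc.isOpen_image.interior_eq, hc.closure_image,
    image_chart_diff hc.closedCell_subset (hc.cell_subset.trans openSquare_subset)
      fun x hx => (hc.cell_subset hx).2.2.2, ← Set.image_union, ← Set.image_union,
    ← Set.image_union]
  congr 1
  ext ⟨l, w⟩
  have ha : a ∈ Set.Icc a b := ⟨le_rfl, hc.lt.le⟩
  have hb : b ∈ Set.Icc a b := ⟨hc.lt.le, le_rfl⟩
  simp only [closedCell, cell, graphArc, verticalArc, Set.mem_sdiff, Set.mem_union,
    Set.mem_ofPred_eq]
  constructor
  · rintro ⟨⟨h1, h2, h3, h4⟩, hn⟩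
    by_contra hcon
    push Not at hcon
    obtain ⟨⟨⟨c1, c2⟩, c3⟩, c4⟩ := hcon
    refine hn ⟨lt_of_le_of_ne h1 ?_, lt_of_le_of_ne h2 ?_,
      lt_of_le_of_ne h3 (c1 h1 h2).symm, lt_of_le_of_ne h4 (c2 h1 h2)⟩
    · rintro rfl; exact absurd h4 (c3 rfl h3).not_ge
    · rintro rfl; exact absurd h4 (c4 rfl h3).not_ge
  · rintro (((⟨h1, h2, rfl⟩ | ⟨h1, h2, rfl⟩) | ⟨rfl, h1, h2⟩) | ⟨rfl, h1, h2⟩)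
    · exact ⟨⟨h1, h2, le_rfl, hc.le _ ⟨h1, h2⟩⟩, fun h => lt_irrefl _ h.2.2.1⟩
    · exact ⟨⟨h1, h2, hc.le _ ⟨h1, h2⟩, le_rfl⟩, fun h => lt_irrefl _ h.2.2.2⟩
    · exact ⟨⟨le_rfl, hc.lt.le, h1, h2⟩, fun h => lt_irrefl _ h.1⟩
    · exact ⟨⟨hc.lt.le, le_rfl, h1, h2⟩, fun h => lt_irrefl _ h.2.1⟩

theorem IsCell.isCurvilinearTriangle (hc : IsCell a b f g) {U V W : ℝ × ℝ}
    {UV VW WU : Set (ℝ × ℝ)} (h₁ : IsSimpleArc UV U V) (h₂ : IsSimpleArc VW V W)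
    (h₃ : IsSimpleArc WU W U) (hV : UV ∩ VW = {V}) (hW : VW ∩ WU = {W}) (hU : WU ∩ UV = {U})
    (hfr : chart '' graphArc f a b ∪ chart '' graphArc g a b ∪
      chart '' verticalArc a (f a) (g a) ∪ chart '' verticalArc b (f b) (g b) = UV ∪ VW ∪ WU) :
    IsCurvilinearTriangle (chart '' cell a b f g) U V W UV VW WU :=
  ⟨h₁, h₂, h₃, hV, hW, hU, hc.isOpen_image, hc.isConnected_image,
    isBounded_image_chart (hc.cell_subset.trans openSquare_subset), hc.frontier_image.trans hfr⟩

end Cell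

/-! ### Simple arcs -/

theorem IsSimpleArc.symm {γ : Set (ℝ × ℝ)} {Y Z : ℝ × ℝ} (h : IsSimpleArc γ Y Z) :
    IsSimpleArc γ Z Y := by
  obtain ⟨f, hf, hr⟩ := h
  exact ⟨f.symm, hf.comp unitInterval.symm_bijective.injective, by rw [Path.symm_range, hr]⟩

theorem isSimpleArc_image {f : ℝ → ℝ × ℝ} {a b : ℝ} (hab : a < b)
    (hf : ContinuousOn f (Set.Icc a b)) (hi : Set.InjOn f (Set.Icc a b)) :
    IsSimpleArc (f '' Set.Icc a b) (f a) (f b) := by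
  have hd := sub_pos.2 hab
  have hm (y : unitInterval) : a + (b - a) * (y : ℝ) ∈ Set.Icc a b := by
    have h0 := y.2.1
    have h1 := y.2.2
    constructor <;> nlinarith
  refine ⟨⟨⟨fun y => f (a + (b - a) * (y : ℝ)), ?_⟩, by simp, by simp⟩, ?_, ?_⟩
  · exact hf.comp_continuous (by fun_prop) hm
  · intro y z hyz
    have h1 := hi (hm y) (hm z) hyz
    exact Subtype.ext (mul_left_cancel₀ hd.ne' (add_left_cancel h1))
  · ext u
    constructor
    · rintro ⟨y, rfl⟩
      exact ⟨_, hm y, rfl⟩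
    · rintro ⟨l, hl, rfl⟩
      refine ⟨⟨(l - a) / (b - a), div_nonneg (by linarith [hl.1]) hd.le,
        (div_le_one hd).2 (by linarith [hl.2])⟩, ?_⟩
      change f (a + (b - a) * ((l - a) / (b - a))) = f l
      congr 1
      field_simp
      ring

theorem image_Icc_eq_graphArc (f : ℝ → ℝ) (a b : ℝ) :
    (fun l => (l, f l)) '' Set.Icc a b = graphArc f a b := by
  ext x
  constructor
  · rintro ⟨l, hl, rfl⟩; exact ⟨hl.1, hl.2, rfl⟩
  · rintro ⟨h1, h2, h3⟩; exact ⟨x.1, ⟨h1, h2⟩, Prod.ext rfl h3.symm⟩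

theorem image_Icc_eq_verticalArc (l a b : ℝ) :
    (fun w => (l, w)) '' Set.Icc a b = verticalArc l a b := by
  ext x
  constructor
  · rintro ⟨w, hw, rfl⟩; exact ⟨rfl, hw.1, hw.2⟩
  · rintro ⟨h1, h2, h3⟩; exact ⟨x.2, ⟨h2, h3⟩, Prod.ext h1.symm rfl⟩

theorem isSimpleArc_graphArc {f : ℝ → ℝ} {a b : ℝ} (h0 : 0 ≤ a) (hab : a < b) (h1 : b ≤ 1)
    (hf : ContinuousOn f (Set.Icc a b)) (hf0 : ∀ l ∈ Set.Icc a b, 0 ≤ f l)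
    (hf1 : ∀ l ∈ Set.Icc a b, f l < 1) :
    IsSimpleArc (chart '' graphArc f a b) (chart (a, f a)) (chart (b, f b)) := by
  rw [← image_Icc_eq_graphArc, ← Set.image_comp]
  have hm : Set.MapsTo (fun l => (l, f l)) (Set.Icc a b) {x ∈ closedSquare | x.2 < 1} :=
    fun l hl => ⟨⟨h0.trans hl.1, hl.2.trans h1, hf0 l hl, (hf1 l hl).le⟩, hf1 l hl⟩
  refine isSimpleArc_image hab ?_ ?_
  · exact continuousOn_chart.comp (by fun_prop) fun l hl => (hm hl).1
  · exact chart_injOn.comp (fun l _ l' _ h => congrArg Prod.fst h) hm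

/-- The end w = 1 is allowed here: on a vertical line the only top-edge point is that end, so the
collapse identifies nothing. -/
theorem isSimpleArc_verticalArc {l a b : ℝ} (hl0 : 0 ≤ l) (hl1 : l ≤ 1) (h0 : 0 ≤ a)
    (hab : a < b) (h1 : b ≤ 1) :
    IsSimpleArc (chart '' verticalArc l a b) (chart (l, a)) (chart (l, b)) := by
  rw [← image_Icc_eq_verticalArc, ← Set.image_comp]
  have hm : Set.MapsTo (fun w => (l, w)) (Set.Icc a b) closedSquare :=
    fun w hw => ⟨hl0, hl1, h0.trans hw.1, hw.2.trans h1⟩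
  refine isSimpleArc_image hab ?_ ?_
  · exact continuousOn_chart.comp (by fun_prop) hm
  · intro w hw w' hw' h
    rcases chart_eq_chart (hm hw) (hm hw') h with h | h
    · exact congrArg Prod.snd h
    · exact h.1.trans h.2.symm

theorem graphArc_subset {f : ℝ → ℝ} {a b : ℝ} (h0 : 0 ≤ a) (h1 : b ≤ 1)
    (hf0 : ∀ l ∈ Set.Icc a b, 0 ≤ f l) (hf1 : ∀ l ∈ Set.Icc a b, f l ≤ 1) :
    graphArc f a b ⊆ closedSquare := by
  rintro x ⟨h2, h3, h4⟩
  exact ⟨h0.trans h2, h3.trans h1, h4 ▸ hf0 _ ⟨h2, h3⟩, h4 ▸ hf1 _ ⟨h2, h3⟩⟩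

theorem verticalArc_subset {l a b : ℝ} (hl0 : 0 ≤ l) (hl1 : l ≤ 1) (h0 : 0 ≤ a) (h1 : b ≤ 1) :
    verticalArc l a b ⊆ closedSquare := by
  rintro x ⟨rfl, h2, h3⟩
  exact ⟨hl0, hl1, h0.trans h2, h3.trans h1⟩

/-! ### Vertices and straight sides -/

theorem chart_ptO : chart (0, 0) = ptO := by
  simp [chart, chartR, chartS, chartT, chartScale, ptO]

theorem chart_ptA : chart (1, 0) = ptA := by
  norm_num [chart, chartR, chartS, chartT, chartScale, ptA]

theorem chart_ptB (l : ℝ) : chart (l, 1) = ptB := by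
  norm_num [chart, chartR, chartS, chartT, chartScale, ptB]

theorem chart_ptD : chart (0, 3 / 5) = ptD := by
  norm_num [chart, chartR, chartS, chartT, chartScale, ptD]

theorem chart_ptE : chart (1, 3 / 5) = ptE := by
  norm_num [chart, chartR, chartS, chartT, chartScale, ptE]

/-- For l = 0 the root t is 0, so c = 0 and b = 9w/(1 + w)², which increases on [0, 1]; the edge is
mapped monotonically onto a segment of the axis. -/
theorem image_chart_verticalArc_zero {a b : ℝ} (h0 : 0 ≤ a) (hab : a ≤ b) (h1 : b ≤ 1) :
    chart '' verticalArc 0 a b = segment ℝ (chart (0, a)) (chart (0, b)) := by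
  have hch (w : ℝ) (hw : 0 ≤ w) : chart (0, w) = (9 * w / (1 + w) ^ 2, 0) := by
    simp [chart, chartR, chartS, chartT, chartScale]
    field_simp
    norm_num [mul_comm]
  have hmono : MonotoneOn (fun w : ℝ => 9 * w / (1 + w) ^ 2) (Set.Icc a b) := by
    intro w hw w' hw' hww
    have hw0 := h0.trans hw.1
    have hw0' := h0.trans hw'.1
    simp only
    rw [div_le_div_iff₀ (by positivity) (by positivity)]
    nlinarith [mul_nonneg (sub_nonneg.2 hww) (sub_nonneg.2 (mul_le_one₀ (hw.2.trans h1) hw0'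
      (hw'.2.trans h1)))]
  have hcont : ContinuousOn (fun w : ℝ => 9 * w / (1 + w) ^ 2) (Set.Icc a b) :=
    ContinuousOn.div (by fun_prop) (by fun_prop) fun w hw => by
      have := h0.trans hw.1
      positivity
  have himg : (fun w : ℝ => 9 * w / (1 + w) ^ 2) '' Set.Icc a b =
      Set.Icc (9 * a / (1 + a) ^ 2) (9 * b / (1 + b) ^ 2) := by
    refine Set.Subset.antisymm ?_ (intermediate_value_Icc hab hcont)
    rintro _ ⟨w, hw, rfl⟩
    exact ⟨hmono ⟨le_rfl, hab⟩ hw hw.1, hmono hw ⟨hab, le_rfl⟩ hw.2⟩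
  have hle := hmono ⟨le_rfl, hab⟩ ⟨hab, le_rfl⟩ hab
  rw [hch a h0, hch b (h0.trans hab), ← Prod.image_mk_segment_left, segment_eq_Icc hle, ← himg,
    ← image_Icc_eq_verticalArc, ← Set.image_comp, ← Set.image_comp]
  exact Set.image_congr fun w hw => hch w (h0.trans hw.1)

/-! ### Passports in the chart -/

section Passports

variable {x : ℝ × ℝ}

theorem g_chart_eq_zero_iff (hx : x ∈ openSquare) : g (chart x) = 0 ↔ x.2 = curveRT x.1 := by
  obtain ⟨K, hK, h⟩ := exists_eval_chartR_sub_chartT hx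
  rw [g_eq_zero_iff_eval (chartR_lt_chartS hx) (chartS_lt_chartT hx) (chartT_neg hx)
    (hasRoots_chart (openSquare_subset hx)), ← sub_eq_zero, h, mul_eq_zero_iff_left hK.ne',
    sub_eq_zero, eq_comm]

theorem h_chart_eq_zero_iff (hx : x ∈ openSquare) :
    h (chart x) = 0 ↔ x.2 = curveR x.1 ∨ x.2 = curveS x.1 := by
  obtain ⟨K, hK, h⟩ := exists_eval_chartR hx
  obtain ⟨K', hK', h'⟩ := exists_eval_chartS hx
  rw [h_eq_zero_iff_eval (chartR_lt_chartS hx) (chartS_lt_chartT hx) (chartT_neg hx)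
    (hasRoots_chart (openSquare_subset hx)), h, h', mul_eq_zero_iff_left hK.ne',
    mul_eq_zero_iff_left hK'.ne', sub_eq_zero, sub_eq_zero, eq_comm,
    eq_comm (a := curveS x.1)]

theorem mul_sub_sign {K a b v : ℝ} (hK : 0 < K) (h : v = K * (a - b)) :
    (0 < v ↔ b < a) ∧ (v < 0 ↔ a < b) ∧ (v = 0 ↔ b = a) := by
  subst h
  refine ⟨by rw [mul_pos_iff_of_pos_left hK, sub_pos], ?_, ?_⟩
  · rw [← neg_pos, ← mul_neg, mul_pos_iff_of_pos_left hK, neg_pos, sub_neg]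
  · rw [mul_eq_zero_iff_left hK.ne', sub_eq_zero, eq_comm]

/-- Here n is the number of critical values. This is `pattern_cases` for p(r), p(s), p(t), 0, with
each comparison of values replaced by the position of the point relative to the corresponding graph.
-/
theorem chart_cases (hx : x ∈ openSquare) :
    ∃ n : ℕ, (IsMorse (p (chart x)) ↔ n = 4) ∧ (IsDegenerateSnake (p (chart x)) ↔ n = 3) ∧
    ((x.2 < curveS x.1 ∧ x.2 < curveRT x.1 ∧ passport (p (chart x)) = [4, 2, 3, 1] ∧ n = 4) ∨
    (x.2 < curveS x.1 ∧ x.2 = curveRT x.1 ∧ passport (p (chart x)) = [3, 2, 3, 1] ∧ n = 3) ∨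
    (x.2 < curveS x.1 ∧ curveRT x.1 < x.2 ∧ passport (p (chart x)) = [3, 2, 4, 1] ∧ n = 4) ∨
    (x.2 = curveS x.1 ∧ x.2 < curveRT x.1 ∧ passport (p (chart x)) = [3, 1, 2, 1] ∧ n = 3) ∨
    (x.2 = curveS x.1 ∧ x.2 = curveRT x.1 ∧ passport (p (chart x)) = [2, 1, 2, 1] ∧ n = 2) ∨
    (x.2 = curveS x.1 ∧ curveRT x.1 < x.2 ∧ passport (p (chart x)) = [2, 1, 3, 1] ∧ n = 3) ∨
    (curveS x.1 < x.2 ∧ x.2 < curveRT x.1 ∧ passport (p (chart x)) = [4, 1, 3, 2] ∧ n = 4) ∨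
    (curveS x.1 < x.2 ∧ x.2 = curveRT x.1 ∧ passport (p (chart x)) = [3, 1, 3, 2] ∧ n = 3) ∨
    (curveS x.1 < x.2 ∧ curveRT x.1 < x.2 ∧ x.2 < curveR x.1 ∧
      passport (p (chart x)) = [3, 1, 4, 2] ∧ n = 4) ∨
    (x.2 = curveR x.1 ∧ passport (p (chart x)) = [2, 1, 3, 2] ∧ n = 3) ∨
    (curveR x.1 < x.2 ∧ passport (p (chart x)) = [2, 1, 4, 3] ∧ n = 4)) := by
  have hrs := chartR_lt_chartS hx
  have hst := chartS_lt_chartT hx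
  have ht := chartT_neg hx
  have hu := hasRoots_chart (openSquare_subset hx)
  obtain ⟨K₁, hK₁, h₁⟩ := exists_eval_chartR_sub_chartT hx
  obtain ⟨K₂, hK₂, h₂⟩ := exists_eval_chartS hx
  obtain ⟨K₃, hK₃, h₃⟩ := exists_eval_chartR hx
  obtain ⟨a1, a2, a3⟩ := mul_sub_sign hK₁ h₁
  obtain ⟨b1, b2, b3⟩ := mul_sub_sign hK₂ h₂
  obtain ⟨c1, c2, c3⟩ := mul_sub_sign hK₃ h₃
  rw [sub_pos] at a1
  rw [sub_neg] at a2
  rw [sub_eq_zero] at a3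
  refine ⟨_, isMorse_p_iff hrs hst ht hu, isDegenerateSnake_p_iff hrs hst ht hu, ?_⟩
  rw [passport_p_eq hrs hst ht hu, ← a1, ← a2, ← a3, ← b1, ← b2, ← b3, ← c1, ← c2, ← c3]
  exact pattern_cases (eval_s_lt_eval_r hrs hst ht hu) (eval_s_lt_eval_t hrs hst ht hu)
    (eval_t_pos hrs hst ht hu)

theorem curveS_lt_curveR_of_mem (hx : x ∈ openSquare) : curveS x.1 < curveR x.1 :=
  curveS_lt_curveR hx.1.le hx.2.1

theorem curveRT_lt_curveR_of_mem (hx : x ∈ openSquare) : curveRT x.1 < curveR x.1 :=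
  curveRT_lt_curveR hx.1 hx.2.1.le

/-- The passports in `chart_cases` are pairwise different, so each selects one row. Rows that locate
the point only relative to `curveR` are settled by `curveS` and `curveRT` lying below `curveR`. The
same reasoning gives the nine equivalences that follow. -/
theorem passport_4231_iff (hx : x ∈ openSquare) :
    IsMorse (p (chart x)) ∧ passport (p (chart x)) = [4, 2, 3, 1] ↔
      x.2 < curveS x.1 ∧ x.2 < curveRT x.1 := by
  obtain ⟨n, hM, hD, hc⟩ := chart_cases hx
  have := curveS_lt_curveR_of_mem hx
  have := curveRT_lt_curveR_of_mem hx
  rcases hc with hc | hc | hc | hc | hc | hc | hc | hc | hc | hc | hc <;> grind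

theorem passport_3241_iff (hx : x ∈ openSquare) :
    IsMorse (p (chart x)) ∧ passport (p (chart x)) = [3, 2, 4, 1] ↔
      x.2 < curveS x.1 ∧ curveRT x.1 < x.2 := by
  obtain ⟨n, hM, hD, hc⟩ := chart_cases hx
  have := curveS_lt_curveR_of_mem hx
  have := curveRT_lt_curveR_of_mem hx
  rcases hc with hc | hc | hc | hc | hc | hc | hc | hc | hc | hc | hc <;> grind

theorem passport_4132_iff (hx : x ∈ openSquare) :
    IsMorse (p (chart x)) ∧ passport (p (chart x)) = [4, 1, 3, 2] ↔
      curveS x.1 < x.2 ∧ x.2 < curveRT x.1 := by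
  obtain ⟨n, hM, hD, hc⟩ := chart_cases hx
  have := curveS_lt_curveR_of_mem hx
  have := curveRT_lt_curveR_of_mem hx
  rcases hc with hc | hc | hc | hc | hc | hc | hc | hc | hc | hc | hc <;> grind

theorem passport_3142_iff (hx : x ∈ openSquare) :
    IsMorse (p (chart x)) ∧ passport (p (chart x)) = [3, 1, 4, 2] ↔
      curveS x.1 < x.2 ∧ curveRT x.1 < x.2 ∧ x.2 < curveR x.1 := by
  obtain ⟨n, hM, hD, hc⟩ := chart_cases hx
  have := curveS_lt_curveR_of_mem hx
  have := curveRT_lt_curveR_of_mem hx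
  rcases hc with hc | hc | hc | hc | hc | hc | hc | hc | hc | hc | hc <;> grind

theorem passport_2143_iff (hx : x ∈ openSquare) :
    IsMorse (p (chart x)) ∧ passport (p (chart x)) = [2, 1, 4, 3] ↔
      curveR x.1 < x.2 := by
  obtain ⟨n, hM, hD, hc⟩ := chart_cases hx
  have := curveS_lt_curveR_of_mem hx
  have := curveRT_lt_curveR_of_mem hx
  rcases hc with hc | hc | hc | hc | hc | hc | hc | hc | hc | hc | hc <;> grind

theorem passport_3231_iff (hx : x ∈ openSquare) :
    IsDegenerateSnake (p (chart x)) ∧ passport (p (chart x)) = [3, 2, 3, 1] ↔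
      x.2 < curveS x.1 ∧ x.2 = curveRT x.1 := by
  obtain ⟨n, hM, hD, hc⟩ := chart_cases hx
  have := curveS_lt_curveR_of_mem hx
  have := curveRT_lt_curveR_of_mem hx
  rcases hc with hc | hc | hc | hc | hc | hc | hc | hc | hc | hc | hc <;> grind

theorem passport_3121_iff (hx : x ∈ openSquare) :
    IsDegenerateSnake (p (chart x)) ∧ passport (p (chart x)) = [3, 1, 2, 1] ↔
      x.2 = curveS x.1 ∧ x.2 < curveRT x.1 := by
  obtain ⟨n, hM, hD, hc⟩ := chart_cases hx
  have := curveS_lt_curveR_of_mem hx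
  have := curveRT_lt_curveR_of_mem hx
  rcases hc with hc | hc | hc | hc | hc | hc | hc | hc | hc | hc | hc <;> grind

theorem passport_3132_iff (hx : x ∈ openSquare) :
    IsDegenerateSnake (p (chart x)) ∧ passport (p (chart x)) = [3, 1, 3, 2] ↔
      curveS x.1 < x.2 ∧ x.2 = curveRT x.1 := by
  obtain ⟨n, hM, hD, hc⟩ := chart_cases hx
  have := curveS_lt_curveR_of_mem hx
  have := curveRT_lt_curveR_of_mem hx
  rcases hc with hc | hc | hc | hc | hc | hc | hc | hc | hc | hc | hc <;> grind

theorem passport_2131_iff (hx : x ∈ openSquare) :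
    IsDegenerateSnake (p (chart x)) ∧ passport (p (chart x)) = [2, 1, 3, 1] ↔
      x.2 = curveS x.1 ∧ curveRT x.1 < x.2 := by
  obtain ⟨n, hM, hD, hc⟩ := chart_cases hx
  have := curveS_lt_curveR_of_mem hx
  have := curveRT_lt_curveR_of_mem hx
  rcases hc with hc | hc | hc | hc | hc | hc | hc | hc | hc | hc | hc <;> grind

theorem passport_2132_iff (hx : x ∈ openSquare) :
    IsDegenerateSnake (p (chart x)) ∧ passport (p (chart x)) = [2, 1, 3, 2] ↔
      x.2 = curveR x.1 := by
  obtain ⟨n, hM, hD, hc⟩ := chart_cases hx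
  have := curveS_lt_curveR_of_mem hx
  have := curveRT_lt_curveR_of_mem hx
  rcases hc with hc | hc | hc | hc | hc | hc | hc | hc | hc | hc | hc <;> grind

theorem passport_of_isMorse (hx : x ∈ openSquare) (hM : IsMorse (p (chart x))) :
    passport (p (chart x)) ∈ ({[4, 2, 3, 1], [3, 2, 4, 1], [4, 1, 3, 2], [3, 1, 4, 2],
      [2, 1, 4, 3]} : Set (List ℕ)) := by
  obtain ⟨n, hM', -, hc⟩ := chart_cases hx
  have hn := hM'.1 hM
  rcases hc with hc | hc | hc | hc | hc | hc | hc | hc | hc | hc | hc <;> grind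

theorem passport_of_isDegenerateSnake (hx : x ∈ openSquare)
    (hD : IsDegenerateSnake (p (chart x))) :
    passport (p (chart x)) ∈ ({[3, 1, 3, 2], [3, 2, 3, 1], [3, 1, 2, 1], [2, 1, 3, 1],
      [2, 1, 3, 2]} : Set (List ℕ)) := by
  obtain ⟨n, -, hD', hc⟩ := chart_cases hx
  have hn := hD'.1 hD
  rcases hc with hc | hc | hc | hc | hc | hc | hc | hc | hc | hc | hc <;> grind

end Passports

theorem region_inter_eq_image {Q : ℝ × ℝ → Prop} {S : Set (ℝ × ℝ)} (hS : S ⊆ openSquare)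
    (h : ∀ x ∈ openSquare, Q (chart x) ↔ x ∈ S) : {u ∈ region | Q u} = chart '' S := by
  rw [region_eq_image]
  ext u
  constructor
  · rintro ⟨⟨x, hx, rfl⟩, hQ⟩
    exact ⟨x, (h x hx).1 hQ, rfl⟩
  · rintro ⟨x, hx, rfl⟩
    exact ⟨⟨x, hS hx, rfl⟩, (h x (hS hx)).2 hx⟩

/-! ### The arcs and triangles of the partition, in the chart -/

def arcOA : Set (ℝ × ℝ) := graphArc (fun _ => 0) 0 1
def arcAB : Set (ℝ × ℝ) := verticalArc 1 0 1
def arcAE : Set (ℝ × ℝ) := verticalArc 1 0 (3 / 5)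
def arcEB : Set (ℝ × ℝ) := verticalArc 1 (3 / 5) 1
def arcOB : Set (ℝ × ℝ) := verticalArc 0 0 1
def arcOD : Set (ℝ × ℝ) := verticalArc 0 0 (3 / 5)
def arcDB : Set (ℝ × ℝ) := verticalArc 0 (3 / 5) 1
def arcAF : Set (ℝ × ℝ) := graphArc curveRT (1 / 2) 1
def arcFD : Set (ℝ × ℝ) := graphArc curveRT 0 (1 / 2)
def arcOF : Set (ℝ × ℝ) := graphArc curveS 0 (1 / 2)
def arcFE : Set (ℝ × ℝ) := graphArc curveS (1 / 2) 1
def arcED : Set (ℝ × ℝ) := graphArc curveR 0 1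

noncomputable def pointF : ℝ × ℝ := (1 / 2, curveRT (1 / 2))

noncomputable def ptF : ℝ × ℝ := chart pointF

/-- The minimum follows `curveS` (side OF) up to l = 1/2 and `curveRT` (side AF) afterwards; its
corner is F. In `cellDEF` the maximum follows FD and then FE. -/
def cellOAF : Set (ℝ × ℝ) := cell 0 1 (fun _ => 0) fun l => min (curveS l) (curveRT l)
def cellAEF : Set (ℝ × ℝ) := cell (1 / 2) 1 curveRT curveS
def cellODF : Set (ℝ × ℝ) := cell 0 (1 / 2) curveS curveRT
def cellDEF : Set (ℝ × ℝ) := cell 0 1 (fun l => max (curveS l) (curveRT l)) curveR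
def cellBDE : Set (ℝ × ℝ) := cell 0 1 curveR fun _ => 1

theorem curveS_le_curveRT {l : ℝ} (h0 : 0 ≤ l) (h1 : l ≤ 1 / 2) : curveS l ≤ curveRT l := by
  rcases eq_or_lt_of_le h1 with rfl | h
  · exact curveS_half.le
  · exact (curveS_lt_curveRT h0 h).le

theorem curveRT_le_curveS {l : ℝ} (h0 : 1 / 2 ≤ l) (h1 : l ≤ 1) : curveRT l ≤ curveS l := by
  rcases eq_or_lt_of_le h0 with rfl | h
  · exact curveS_half.ge
  · exact (curveRT_lt_curveS h h1).le

theorem curveRT_eq_curveS_iff {l : ℝ} (h0 : 0 ≤ l) (h1 : l ≤ 1) :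
    curveRT l = curveS l ↔ l = 1 / 2 := by
  constructor
  · intro h
    rcases lt_trichotomy l (1 / 2) with hl | hl | hl
    · exact absurd h (curveS_lt_curveRT h0 hl).ne'
    · exact hl
    · exact absurd h (curveRT_lt_curveS hl h1).ne
  · rintro rfl; exact curveS_half.symm

theorem isCell_OAF : IsCell 0 1 (fun _ => 0) fun l => min (curveS l) (curveRT l) where
  left := le_rfl
  lt := zero_lt_one
  right := le_rfl
  cont_lower := continuousOn_const
  cont_upper := continuousOn_curveS.inf continuousOn_curveRT
  nonneg _ _ := le_rfl
  le _ hl := le_min (curveS_nonneg hl.1 hl.2) (curveRT_nonneg hl.1 hl.2)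
  le_one _ hl := (min_le_left _ _).trans (curveS_lt_one hl.1 hl.2).le
  lt_of_mem _ hl := lt_min (curveS_pos hl.1 hl.2.le) (curveRT_pos hl.1.le hl.2)

theorem half_Icc_subset : Set.Icc (1 / 2 : ℝ) 1 ⊆ Set.Icc 0 1 :=
  Set.Icc_subset_Icc (by norm_num) le_rfl

theorem Icc_half_subset : Set.Icc (0 : ℝ) (1 / 2) ⊆ Set.Icc 0 1 :=
  Set.Icc_subset_Icc le_rfl (by norm_num)

theorem isCell_AEF : IsCell (1 / 2) 1 curveRT curveS where
  left := by norm_num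
  lt := by norm_num
  right := le_rfl
  cont_lower := continuousOn_curveRT.mono half_Icc_subset
  cont_upper := continuousOn_curveS.mono half_Icc_subset
  nonneg _ hl := curveRT_nonneg (half_Icc_subset hl).1 hl.2
  le _ hl := curveRT_le_curveS hl.1 hl.2
  le_one _ hl := (curveS_lt_one (half_Icc_subset hl).1 hl.2).le
  lt_of_mem _ hl := curveRT_lt_curveS hl.1 hl.2.le

theorem isCell_ODF : IsCell 0 (1 / 2) curveS curveRT where
  left := le_rfl
  lt := by norm_num
  right := by norm_num
  cont_lower := continuousOn_curveS.mono Icc_half_subset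
  cont_upper := continuousOn_curveRT.mono Icc_half_subset
  nonneg _ hl := curveS_nonneg hl.1 (Icc_half_subset hl).2
  le _ hl := curveS_le_curveRT hl.1 hl.2
  le_one _ hl := (curveRT_lt_one hl.1 (Icc_half_subset hl).2).le
  lt_of_mem _ hl := curveS_lt_curveRT hl.1.le hl.2

theorem curveS_le_curveR {l : ℝ} (h0 : 0 ≤ l) (h1 : l ≤ 1) : curveS l ≤ curveR l := by
  rcases eq_or_lt_of_le h1 with rfl | h
  · rw [curveS_one, curveR_one]
  · exact (curveS_lt_curveR h0 h).le

theorem curveRT_le_curveR {l : ℝ} (h0 : 0 ≤ l) (h1 : l ≤ 1) : curveRT l ≤ curveR l := by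
  rcases eq_or_lt_of_le h0 with rfl | h
  · rw [curveRT_zero, curveR_zero]
  · exact (curveRT_lt_curveR h h1).le

theorem isCell_DEF : IsCell 0 1 (fun l => max (curveS l) (curveRT l)) curveR where
  left := le_rfl
  lt := zero_lt_one
  right := le_rfl
  cont_lower := continuousOn_curveS.sup continuousOn_curveRT
  cont_upper := continuousOn_curveR
  nonneg _ hl := (curveS_nonneg hl.1 hl.2).trans (le_max_left _ _)
  le _ hl := max_le (curveS_le_curveR hl.1 hl.2) (curveRT_le_curveR hl.1 hl.2)
  le_one _ _ := curveR_lt_one.le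
  lt_of_mem _ hl := max_lt (curveS_lt_curveR hl.1.le hl.2) (curveRT_lt_curveR hl.1 hl.2.le)

theorem isCell_BDE : IsCell 0 1 curveR fun _ => 1 where
  left := le_rfl
  lt := zero_lt_one
  right := le_rfl
  cont_lower := continuousOn_curveR
  cont_upper := continuousOn_const
  nonneg _ _ := curveR_nonneg
  le _ _ := curveR_lt_one.le
  le_one _ _ := le_rfl
  lt_of_mem _ _ := curveR_lt_one

theorem isCell_OAB : IsCell 0 1 (fun _ => 0) fun _ => 1 where
  left := le_rfl
  lt := zero_lt_one
  right := le_rfl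
  cont_lower := continuousOn_const
  cont_upper := continuousOn_const
  nonneg _ _ := le_rfl
  le _ _ := zero_le_one
  le_one _ _ := le_rfl
  lt_of_mem _ _ := zero_lt_one

/-! ### The arcs are simple -/

theorem isSimpleArc_OA : IsSimpleArc (chart '' arcOA) ptO ptA := by
  rw [← chart_ptO, ← chart_ptA]
  exact isSimpleArc_graphArc le_rfl zero_lt_one le_rfl continuousOn_const (fun _ _ => le_rfl)
    fun _ _ => zero_lt_one

theorem isSimpleArc_AB : IsSimpleArc (chart '' arcAB) ptA ptB := by
  rw [← chart_ptA, ← chart_ptB 1]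
  exact isSimpleArc_verticalArc zero_le_one le_rfl le_rfl zero_lt_one le_rfl

theorem isSimpleArc_AE : IsSimpleArc (chart '' arcAE) ptA ptE := by
  rw [← chart_ptA, ← chart_ptE]
  exact isSimpleArc_verticalArc zero_le_one le_rfl le_rfl (by norm_num) (by norm_num)

theorem isSimpleArc_EB : IsSimpleArc (chart '' arcEB) ptE ptB := by
  rw [← chart_ptE, ← chart_ptB 1]
  exact isSimpleArc_verticalArc zero_le_one le_rfl (by norm_num) (by norm_num) le_rfl

theorem isSimpleArc_OB : IsSimpleArc (chart '' arcOB) ptO ptB := by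
  rw [← chart_ptO, ← chart_ptB 0]
  exact isSimpleArc_verticalArc le_rfl zero_le_one le_rfl zero_lt_one le_rfl

theorem isSimpleArc_OD : IsSimpleArc (chart '' arcOD) ptO ptD := by
  rw [← chart_ptO, ← chart_ptD]
  exact isSimpleArc_verticalArc le_rfl zero_le_one le_rfl (by norm_num) (by norm_num)

theorem isSimpleArc_DB : IsSimpleArc (chart '' arcDB) ptD ptB := by
  rw [← chart_ptD, ← chart_ptB 0]
  exact isSimpleArc_verticalArc le_rfl zero_le_one (by norm_num) (by norm_num) le_rfl

theorem isSimpleArc_AF : IsSimpleArc (chart '' arcAF) ptA ptF := by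
  rw [← chart_ptA, ptF, pointF, ← curveRT_one]
  exact (isSimpleArc_graphArc isCell_AEF.left isCell_AEF.lt le_rfl isCell_AEF.cont_lower
    isCell_AEF.nonneg fun l hl => curveRT_lt_one (half_Icc_subset hl).1 hl.2).symm

theorem isSimpleArc_FE : IsSimpleArc (chart '' arcFE) ptF ptE := by
  rw [← chart_ptE, ptF, pointF, ← curveS_one, ← curveS_half]
  exact isSimpleArc_graphArc isCell_AEF.left isCell_AEF.lt le_rfl isCell_AEF.cont_upper
    (fun l hl => curveS_nonneg (half_Icc_subset hl).1 hl.2)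
    fun l hl => curveS_lt_one (half_Icc_subset hl).1 hl.2

theorem isSimpleArc_FD : IsSimpleArc (chart '' arcFD) ptF ptD := by
  rw [← chart_ptD, ptF, pointF, ← curveRT_zero]
  exact (isSimpleArc_graphArc le_rfl isCell_ODF.lt isCell_ODF.right isCell_ODF.cont_upper
    (fun l hl => curveRT_nonneg hl.1 (Icc_half_subset hl).2)
    fun l hl => curveRT_lt_one hl.1 (Icc_half_subset hl).2).symm

theorem isSimpleArc_OF : IsSimpleArc (chart '' arcOF) ptO ptF := by
  rw [← chart_ptO, ptF, pointF, ← curveS_half, show ((0 : ℝ), (0 : ℝ)) = (0, curveS 0) by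
    rw [curveS_zero]]
  exact isSimpleArc_graphArc le_rfl isCell_ODF.lt isCell_ODF.right isCell_ODF.cont_lower
    isCell_ODF.nonneg fun l hl => curveS_lt_one hl.1 (Icc_half_subset hl).2

theorem isSimpleArc_ED : IsSimpleArc (chart '' arcED) ptE ptD := by
  rw [← chart_ptE, ← chart_ptD, show ((1 : ℝ), (3 / 5 : ℝ)) = (1, curveR 1) by rw [curveR_one],
    ← curveR_zero]
  exact (isSimpleArc_graphArc le_rfl zero_lt_one le_rfl continuousOn_curveR
    (fun _ _ => curveR_nonneg) fun _ _ => curveR_lt_one).symm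

/-! ### Common points of the arcs -/

/-- A subset of the unit square on which the chart is injective. -/
def IsLow (S : Set (ℝ × ℝ)) : Prop := S ⊆ closedSquare ∧ ∀ x ∈ S, x.2 < 1

theorem isLow_graphArc {f : ℝ → ℝ} {a b : ℝ} (h0 : 0 ≤ a) (h1 : b ≤ 1)
    (hf0 : ∀ l ∈ Set.Icc a b, 0 ≤ f l) (hf1 : ∀ l ∈ Set.Icc a b, f l < 1) :
    IsLow (graphArc f a b) :=
  ⟨graphArc_subset h0 h1 hf0 fun l hl => (hf1 l hl).le,
    fun x hx => hx.2.2 ▸ hf1 x.1 ⟨hx.1, hx.2.1⟩⟩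

theorem isLow_OA : IsLow arcOA :=
  isLow_graphArc le_rfl le_rfl (fun _ _ => le_rfl) fun _ _ => zero_lt_one

theorem isLow_AF : IsLow arcAF :=
  isLow_graphArc isCell_AEF.left le_rfl isCell_AEF.nonneg
    fun _ hl => curveRT_lt_one (half_Icc_subset hl).1 hl.2

theorem isLow_FE : IsLow arcFE :=
  isLow_graphArc isCell_AEF.left le_rfl
    (fun _ hl => curveS_nonneg (half_Icc_subset hl).1 hl.2)
    fun _ hl => curveS_lt_one (half_Icc_subset hl).1 hl.2

theorem isLow_FD : IsLow arcFD :=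
  isLow_graphArc le_rfl isCell_ODF.right
    (fun _ hl => curveRT_nonneg hl.1 (Icc_half_subset hl).2)
    fun _ hl => curveRT_lt_one hl.1 (Icc_half_subset hl).2

theorem isLow_OF : IsLow arcOF :=
  isLow_graphArc le_rfl isCell_ODF.right isCell_ODF.nonneg
    fun _ hl => curveS_lt_one hl.1 (Icc_half_subset hl).2

theorem isLow_ED : IsLow arcED :=
  isLow_graphArc le_rfl le_rfl (fun _ _ => curveR_nonneg) fun _ _ => curveR_lt_one

theorem image_inter_graphArc {f k : ℝ → ℝ} {a b c d l : ℝ} (hS : IsLow (graphArc f a b))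
    (hT : IsLow (graphArc k c d)) (h1 : l ∈ Set.Icc a b) (h2 : l ∈ Set.Icc c d) (h3 : f l = k l)
    (h : ∀ y ∈ Set.Icc a b, y ∈ Set.Icc c d → f y = k y → y = l) :
    chart '' graphArc f a b ∩ chart '' graphArc k c d = {chart (l, f l)} := by
  rw [image_chart_inter hS.1 hT.1 hS.2, ← Set.image_singleton]
  congr 1
  ext ⟨y, w⟩
  constructor
  · rintro ⟨⟨h4, h5, h6⟩, h7, h8, h9⟩
    obtain rfl := h y ⟨h4, h5⟩ ⟨h7, h8⟩ (h6.symm.trans h9)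
    exact Prod.ext rfl h6
  · intro hy
    rw [Set.mem_singleton_iff] at hy
    rw [hy]
    exact ⟨⟨h1.1, h1.2, rfl⟩, h2.1, h2.2, h3⟩

theorem image_inter_verticalArc {f : ℝ → ℝ} {a b c d l : ℝ} (hS : IsLow (graphArc f a b))
    (hT : verticalArc l c d ⊆ closedSquare) (h1 : l ∈ Set.Icc a b) (h2 : f l ∈ Set.Icc c d) :
    chart '' graphArc f a b ∩ chart '' verticalArc l c d = {chart (l, f l)} := by
  rw [image_chart_inter hS.1 hT hS.2, ← Set.image_singleton]
  congr 1
  ext ⟨y, w⟩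
  constructor
  · rintro ⟨⟨h4, h5, h6⟩, h7, h8, h9⟩
    simp only at h7
    subst h7
    exact Prod.ext rfl h6
  · intro hy
    rw [Set.mem_singleton_iff] at hy
    rw [hy]
    exact ⟨⟨h1.1, h1.2, rfl⟩, rfl, h2.1, h2.2⟩

/-- The two vertical edges are disjoint in the square; their images meet only because both upper
ends are sent to B. -/
theorem image_inter_verticalArc_verticalArc {a c : ℝ} (ha0 : 0 ≤ a) (ha1 : a ≤ 1) (hc0 : 0 ≤ c)
    (hc1 : c ≤ 1) : chart '' verticalArc 0 a 1 ∩ chart '' verticalArc 1 c 1 = {ptB} := by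
  ext u
  constructor
  · rintro ⟨⟨x, hx, rfl⟩, y, hy, hxy⟩
    rcases chart_eq_chart (verticalArc_subset zero_le_one le_rfl hc0 le_rfl hy)
      (verticalArc_subset le_rfl zero_le_one ha0 le_rfl hx) hxy with h | h
    · have h3 := hx.1
      rw [← h, hy.1] at h3
      norm_num at h3
    · rw [Set.mem_singleton_iff, ← chart_ptB x.1, ← h.2]
  · rintro rfl
    exact ⟨⟨(0, 1), ⟨rfl, ha1, le_rfl⟩, chart_ptB 0⟩, (1, 1), ⟨rfl, hc1, le_rfl⟩, chart_ptB 1⟩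

theorem zero_mem_Icc : (0 : ℝ) ∈ Set.Icc (0 : ℝ) 1 := ⟨le_rfl, zero_le_one⟩

theorem one_mem_Icc : (1 : ℝ) ∈ Set.Icc (0 : ℝ) 1 := ⟨zero_le_one, le_rfl⟩

theorem inter_OA_AB : chart '' arcOA ∩ chart '' arcAB = {ptA} :=
  chart_ptA ▸ image_inter_verticalArc isLow_OA
    (verticalArc_subset zero_le_one le_rfl le_rfl le_rfl) one_mem_Icc zero_mem_Icc

theorem inter_OA_OB : chart '' arcOA ∩ chart '' arcOB = {ptO} :=
  chart_ptO ▸ image_inter_verticalArc isLow_OA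
    (verticalArc_subset le_rfl zero_le_one le_rfl le_rfl) zero_mem_Icc zero_mem_Icc

theorem inter_OA_AF : chart '' arcOA ∩ chart '' arcAF = {ptA} := by
  rw [← chart_ptA]
  refine image_inter_graphArc (f := fun _ => 0) isLow_OA isLow_AF one_mem_Icc ⟨by norm_num, le_rfl⟩
    curveRT_one.symm fun y hy _ h => ?_
  by_contra hne
  exact absurd h (curveRT_pos hy.1 (lt_of_le_of_ne hy.2 hne)).ne

theorem inter_OA_OF : chart '' arcOA ∩ chart '' arcOF = {ptO} := by
  rw [← chart_ptO]
  refine image_inter_graphArc (f := fun _ => 0) isLow_OA isLow_OF zero_mem_Icc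
    ⟨le_rfl, by norm_num⟩ curveS_zero.symm fun y hy _ h => ?_
  by_contra hne
  exact absurd h (curveS_pos (lt_of_le_of_ne hy.1 (Ne.symm hne)) hy.2).ne

theorem inter_AF_OF : chart '' arcAF ∩ chart '' arcOF = {ptF} :=
  image_inter_graphArc isLow_AF isLow_OF ⟨le_rfl, by norm_num⟩ ⟨by norm_num, le_rfl⟩
    curveS_half.symm fun _ hy hy' _ => le_antisymm hy'.2 hy.1

theorem inter_AF_FE : chart '' arcAF ∩ chart '' arcFE = {ptF} :=
  image_inter_graphArc isLow_AF isLow_FE ⟨le_rfl, by norm_num⟩ ⟨le_rfl, by norm_num⟩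
    curveS_half.symm fun _ hy _ h => (curveRT_eq_curveS_iff (half_Icc_subset hy).1 hy.2).1 h

theorem inter_FD_OF : chart '' arcFD ∩ chart '' arcOF = {ptF} :=
  image_inter_graphArc isLow_FD isLow_OF ⟨by norm_num, le_rfl⟩ ⟨by norm_num, le_rfl⟩
    curveS_half.symm fun _ hy _ h => (curveRT_eq_curveS_iff hy.1 (Icc_half_subset hy).2).1 h

theorem inter_FD_FE : chart '' arcFD ∩ chart '' arcFE = {ptF} :=
  image_inter_graphArc isLow_FD isLow_FE ⟨by norm_num, le_rfl⟩ ⟨le_rfl, by norm_num⟩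
    curveS_half.symm fun _ hy hy' _ => le_antisymm hy.2 hy'.1

theorem inter_FD_ED : chart '' arcFD ∩ chart '' arcED = {ptD} := by
  rw [← chart_ptD, ← curveRT_zero]
  refine image_inter_graphArc isLow_FD isLow_ED ⟨le_rfl, by norm_num⟩ zero_mem_Icc
    (curveRT_zero.trans curveR_zero.symm) fun y hy hy' h => ?_
  by_contra hne
  exact absurd h (curveRT_lt_curveR (lt_of_le_of_ne hy.1 (Ne.symm hne)) hy'.2).ne

theorem inter_FE_ED : chart '' arcFE ∩ chart '' arcED = {ptE} := by
  rw [← chart_ptE, ← curveS_one]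
  refine image_inter_graphArc isLow_FE isLow_ED ⟨by norm_num, le_rfl⟩ one_mem_Icc
    (curveS_one.trans curveR_one.symm) fun y hy hy' h => ?_
  by_contra hne
  exact absurd h (curveS_lt_curveR hy'.1 (lt_of_le_of_ne hy.2 hne)).ne

theorem inter_FE_AE : chart '' arcFE ∩ chart '' arcAE = {ptE} := by
  rw [← chart_ptE, ← curveS_one]
  exact image_inter_verticalArc isLow_FE
    (verticalArc_subset zero_le_one le_rfl le_rfl (by norm_num)) ⟨by norm_num, le_rfl⟩
    (by rw [curveS_one]; norm_num)

theorem inter_AF_AE : chart '' arcAF ∩ chart '' arcAE = {ptA} := by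
  rw [← chart_ptA, ← curveRT_one]
  exact image_inter_verticalArc isLow_AF
    (verticalArc_subset zero_le_one le_rfl le_rfl (by norm_num)) ⟨by norm_num, le_rfl⟩
    (by rw [curveRT_one]; norm_num)

theorem inter_FD_OD : chart '' arcFD ∩ chart '' arcOD = {ptD} := by
  rw [← chart_ptD, ← curveRT_zero]
  exact image_inter_verticalArc isLow_FD
    (verticalArc_subset le_rfl zero_le_one le_rfl (by norm_num)) ⟨le_rfl, by norm_num⟩
    (by rw [curveRT_zero]; norm_num)

theorem inter_OF_OD : chart '' arcOF ∩ chart '' arcOD = {ptO} := by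
  have h := image_inter_verticalArc (l := 0) isLow_OF
    (verticalArc_subset le_rfl zero_le_one le_rfl (by norm_num)) ⟨le_rfl, by norm_num⟩
    (c := 0) (d := 3 / 5) (by rw [curveS_zero]; norm_num)
  rwa [curveS_zero, chart_ptO] at h

theorem inter_ED_DB : chart '' arcED ∩ chart '' arcDB = {ptD} := by
  rw [← chart_ptD, ← curveR_zero]
  exact image_inter_verticalArc isLow_ED
    (verticalArc_subset le_rfl zero_le_one (by norm_num) le_rfl) zero_mem_Icc
    (by rw [curveR_zero]; norm_num)

theorem inter_ED_EB : chart '' arcED ∩ chart '' arcEB = {ptE} := by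
  rw [← chart_ptE, ← curveR_one]
  exact image_inter_verticalArc isLow_ED
    (verticalArc_subset zero_le_one le_rfl (by norm_num) le_rfl) one_mem_Icc
    (by rw [curveR_one]; norm_num)

/-! ### The triangles -/

/-- Both vertical sides of this cell are single points, over O and over A, because `curveS` vanishes
at 0 and `curveRT` at 1. Splitting the upper boundary at l = 1/2 leaves three sides. -/
theorem triangle_OAF : IsCurvilinearTriangle (chart '' cellOAF) ptO ptA ptF
    (chart '' arcOA) (chart '' arcAF) (chart '' arcOF) := by
  refine isCell_OAF.isCurvilinearTriangle isSimpleArc_OA isSimpleArc_AF isSimpleArc_OF.symm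
    inter_OA_AF inter_AF_OF (by rw [Set.inter_comm, inter_OA_OF]) ?_
  simp only [← Set.image_union, curveS_zero, curveRT_zero, curveS_one, curveRT_one]
  congr 1
  ext ⟨l, w⟩
  simp only [arcOA, arcAF, arcOF, graphArc, verticalArc, Set.mem_union, Set.mem_ofPred_eq]
  have := @curveS_le_curveRT l
  have := @curveRT_le_curveS l
  norm_num
  grind

theorem triangle_AEF : IsCurvilinearTriangle (chart '' cellAEF) ptA ptE ptF
    (chart '' arcAE) (chart '' arcFE) (chart '' arcAF) := by
  refine isCell_AEF.isCurvilinearTriangle isSimpleArc_AE isSimpleArc_FE.symm isSimpleArc_AF.symm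
    (by rw [Set.inter_comm, inter_FE_AE]) (by rw [Set.inter_comm, inter_AF_FE]) inter_AF_AE ?_
  simp only [← Set.image_union, curveS_one, curveRT_one, curveS_half]
  congr 1
  ext ⟨l, w⟩
  simp only [arcAE, arcFE, arcAF, graphArc, verticalArc, Set.mem_union, Set.mem_ofPred_eq]
  have h0 : (0 : ℝ) < 1 / 2 := by norm_num
  have h1 : (1 / 2 : ℝ) < 1 := by norm_num
  generalize (1 / 2 : ℝ) = c at *
  grind

theorem triangle_ODF : IsCurvilinearTriangle (chart '' cellODF) ptO ptD ptF
    (chart '' arcOD) (chart '' arcFD) (chart '' arcOF) := by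
  refine isCell_ODF.isCurvilinearTriangle isSimpleArc_OD isSimpleArc_FD.symm isSimpleArc_OF.symm
    (by rw [Set.inter_comm, inter_FD_OD]) inter_FD_OF inter_OF_OD ?_
  simp only [← Set.image_union, curveS_zero, curveRT_zero, curveS_half]
  congr 1
  ext ⟨l, w⟩
  simp only [arcOD, arcFD, arcOF, graphArc, verticalArc, Set.mem_union, Set.mem_ofPred_eq]
  have h0 : (0 : ℝ) < 1 / 2 := by norm_num
  have h1 : (1 / 2 : ℝ) < 1 := by norm_num
  generalize (1 / 2 : ℝ) = c at *
  grind

theorem triangle_DEF : IsCurvilinearTriangle (chart '' cellDEF) ptD ptE ptF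
    (chart '' arcED) (chart '' arcFE) (chart '' arcFD) := by
  refine isCell_DEF.isCurvilinearTriangle isSimpleArc_ED.symm isSimpleArc_FE.symm isSimpleArc_FD
    (by rw [Set.inter_comm, inter_FE_ED]) (by rw [Set.inter_comm, inter_FD_FE]) inter_FD_ED ?_
  simp only [← Set.image_union, curveS_zero, curveRT_zero, curveS_one, curveRT_one, curveR_zero,
    curveR_one]
  congr 1
  ext ⟨l, w⟩
  simp only [arcED, arcFE, arcFD, graphArc, verticalArc, Set.mem_union, Set.mem_ofPred_eq]
  have := @curveS_le_curveRT l
  have := @curveRT_le_curveS l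
  have := curveR_zero
  have := curveR_one
  norm_num
  grind

theorem image_chart_top : chart '' graphArc (fun _ => 1) 0 1 = {ptB} := by
  ext u
  constructor
  · rintro ⟨⟨l, w⟩, ⟨-, -, h⟩, rfl⟩
    simp only at h
    rw [h, chart_ptB, Set.mem_singleton_iff]
  · rintro rfl
    exact ⟨(0, 1), ⟨le_rfl, zero_le_one, rfl⟩, chart_ptB 0⟩

theorem triangle_BDE : IsCurvilinearTriangle (chart '' cellBDE) ptB ptD ptE
    (chart '' arcDB) (chart '' arcED) (chart '' arcEB) := by
  refine isCell_BDE.isCurvilinearTriangle isSimpleArc_DB.symm isSimpleArc_ED.symm isSimpleArc_EB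
    (by rw [Set.inter_comm, inter_ED_DB]) inter_ED_EB ?_ ?_
  · rw [Set.inter_comm]
    exact image_inter_verticalArc_verticalArc (by norm_num) (by norm_num) (by norm_num)
      (by norm_num)
  · have hB : ptB ∈ chart '' arcDB := ⟨(0, 1), ⟨rfl, by norm_num, le_rfl⟩, chart_ptB 0⟩
    rw [image_chart_top, curveR_zero, curveR_one]
    change chart '' arcED ∪ {ptB} ∪ chart '' arcDB ∪ chart '' arcEB = _
    ext u
    simp only [Set.mem_union, Set.mem_singleton_iff]
    grind

theorem triangle_OAB : IsCurvilinearTriangle region ptO ptA ptB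
    (chart '' arcOA) (chart '' arcAB) (chart '' arcOB) := by
  have hreg : region = chart '' cell 0 1 (fun _ => 0) fun _ => 1 := region_eq_image
  rw [hreg]
  refine isCell_OAB.isCurvilinearTriangle isSimpleArc_OA isSimpleArc_AB isSimpleArc_OB.symm
    inter_OA_AB ?_ (by rw [Set.inter_comm, inter_OA_OB]) ?_
  · rw [Set.inter_comm]
    exact image_inter_verticalArc_verticalArc le_rfl zero_le_one le_rfl zero_le_one
  · have hB : ptB ∈ chart '' arcOB := ⟨(0, 1), ⟨rfl, zero_le_one, le_rfl⟩, chart_ptB 0⟩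
    rw [image_chart_top]
    change chart '' arcOA ∪ {ptB} ∪ chart '' arcOB ∪ chart '' arcAB = _
    ext u
    simp only [Set.mem_union, Set.mem_singleton_iff]
    grind

/-! ### The curves and the triangles in the plane -/

theorem image_AE_union_EB : chart '' arcAE ∪ chart '' arcEB = chart '' arcAB := by
  rw [← Set.image_union]
  congr 1
  ext ⟨l, w⟩
  simp only [arcAE, arcEB, arcAB, verticalArc, Set.mem_union, Set.mem_ofPred_eq]
  constructor
  · rintro (⟨h1, h2, h3⟩ | ⟨h1, h2, h3⟩)
    · exact ⟨h1, h2, by linarith⟩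
    · exact ⟨h1, by linarith, h3⟩
  · rintro ⟨h1, h2, h3⟩
    rcases le_total w (3 / 5) with h | h
    · exact Or.inl ⟨h1, h2, h⟩
    · exact Or.inr ⟨h1, h, h3⟩

theorem image_OB : chart '' arcOB = segment ℝ ptB ptO := by
  rw [segment_symm, ← chart_ptO, ← chart_ptB 0]
  exact image_chart_verticalArc_zero le_rfl zero_le_one le_rfl

theorem image_OD : chart '' arcOD = segment ℝ ptO ptD := by
  rw [← chart_ptO, ← chart_ptD]
  exact image_chart_verticalArc_zero le_rfl (by norm_num) (by norm_num)

theorem image_DB : chart '' arcDB = segment ℝ ptB ptD := by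
  rw [segment_symm, ← chart_ptB 0, ← chart_ptD]
  exact image_chart_verticalArc_zero (by norm_num) (by norm_num) le_rfl

/-- `dq` is the square of the product of the root differences, so it vanishes when r = s, which is
the edge l = 1 or the top edge, or when s = t, which is the edge w = 0. -/
theorem discriminant_curve_eq :
    {u | 0 ≤ u.1 ∧ 0 ≤ u.2 ∧ dq u = 0} = chart '' arcOA ∪ chart '' arcAB := by
  ext u
  constructor
  · rintro ⟨hb, hc, hd⟩
    obtain ⟨r, s, t, hrs, hst, ht, hu⟩ := exists_sorted_hasRoots hb hc hd.ge
    obtain ⟨x, hx, rfl, rfl, rfl, rfl⟩ := exists_chart_eq hrs hst ht hu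
    rw [hu.dq_eq, sq_eq_zero_iff, mul_eq_zero, mul_eq_zero] at hd
    have hk := (chartScale_pos hx).ne'
    have hcases : chartR x = chartS x ∨ chartS x = chartT x := by
      rcases hd with (h | h) | h
      · left; linarith
      · right; linarith
      · left; linarith
    rcases hcases with h | h
    · right
      have h0 : chartScale x * ((1 - x.1) * (1 - x.2)) = 0 := by
        rw [chartR, chartS] at h; linarith
      rcases mul_eq_zero.1 ((mul_eq_zero_iff_left hk).1 h0) with h1 | h1
      · exact ⟨x, ⟨by linarith, hx.2.2.1, hx.2.2.2⟩, rfl⟩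
      · refine ⟨(1, 1), ⟨rfl, zero_le_one, le_rfl⟩, ?_⟩
        rw [show x = (x.1, 1) from Prod.ext rfl (by linarith), chart_ptB, chart_ptB]
    · left
      have h0 : chartScale x * x.2 = 0 := by rw [chartS, chartT] at h; linarith
      exact ⟨x, ⟨hx.1, hx.2.1, (mul_eq_zero_iff_left hk).1 h0⟩, rfl⟩
  · intro hu
    obtain ⟨x, hx, hd, rfl⟩ : ∃ x ∈ closedSquare, (1 - x.1) * x.2 = 0 ∧ chart x = u := by
      rcases hu with ⟨x, hx, rfl⟩ | ⟨x, hx, rfl⟩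
      · exact ⟨x, isLow_OA.1 hx, by rw [hx.2.2, mul_zero], rfl⟩
      · exact ⟨x, verticalArc_subset zero_le_one le_rfl le_rfl le_rfl hx,
          by rw [hx.1, sub_self, zero_mul], rfl⟩
    have hu := hasRoots_chart hx
    have h1 := chartR_le_chartS hx
    have h2 := chartS_le_chartT hx
    have h3 := chartT_nonpos hx
    refine ⟨?_, ?_, ?_⟩
    · rw [hu.2.1]
      nlinarith [mul_nonneg (neg_nonneg.2 (h1.trans (h2.trans h3))) (neg_nonneg.2 (h2.trans h3)),
        mul_nonneg (neg_nonneg.2 (h1.trans (h2.trans h3))) (neg_nonneg.2 h3),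
        mul_nonneg (neg_nonneg.2 (h2.trans h3)) (neg_nonneg.2 h3)]
    · rw [hu.2.2]
      have := mul_nonneg (mul_nonneg (neg_nonneg.2 (h1.trans (h2.trans h3)))
        (neg_nonneg.2 (h2.trans h3))) (neg_nonneg.2 h3)
      linarith
    · rw [hu.dq_eq]
      have e : (chartS x - chartR x) * (chartT x - chartS x) =
          chartScale x ^ 2 * (1 - x.2) * ((1 - x.1) * x.2) := by
        rw [chartR, chartS, chartT]; ring
      rw [e, hd]; ring

theorem pointF_mem : pointF ∈ openSquare :=
  ⟨by norm_num [pointF], by norm_num [pointF], curveRT_pos (by norm_num) (by norm_num),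
    curveRT_lt_one (by norm_num) (by norm_num)⟩

theorem intersection_eq : {u ∈ region | g u = 0 ∧ h u = 0} = {ptF} := by
  rw [ptF, ← Set.image_singleton]
  refine region_inter_eq_image (Set.singleton_subset_iff.2 pointF_mem) fun x hx => ?_
  rw [g_chart_eq_zero_iff hx, h_chart_eq_zero_iff hx, Set.mem_singleton_iff]
  constructor
  · rintro ⟨h1, h2 | h2⟩
    · exact absurd (h1.symm.trans h2) (curveRT_lt_curveR_of_mem hx).ne
    · have hl := (curveRT_eq_curveS_iff hx.1.le hx.2.1.le).1 (h1.symm.trans h2)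
      exact Prod.ext hl (by rw [h1, hl, pointF])
  · rintro rfl
    exact ⟨rfl, Or.inr curveS_half.symm⟩

/-- At l = 1/2 the threshold has m = -2 and n = 2, hence the square root of 20. This accuracy
suffices for both coordinates of F. -/
theorem curveRT_half_bounds : 0.38 < curveRT (1 / 2) ∧ curveRT (1 / 2) < 0.383 := by
  have h : curveRT (1 / 2) = (-2 + √20) / (2 + √20) := by
    rw [curveRT, threshold]; norm_num; ring
  have h1 : (4.47 : ℝ) < √20 := Real.lt_sqrt_of_sq_lt (by norm_num)
  have h2 : √20 < (4.48 : ℝ) := (Real.sqrt_lt' (by norm_num)).2 (by norm_num)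
  rw [h, lt_div_iff₀ (by linarith), div_lt_iff₀ (by linarith)]
  constructor <;> linarith

theorem ptF_eq : ptF = (9 / 4 + 9 / 16 * (1 - curveRT (1 / 2) ^ 2),
    27 / 32 * (1 - curveRT (1 / 2) ^ 2)) := by
  have hs : chartScale pointF = 3 / 2 := by
    rw [chartScale, pointF]; ring
  rw [ptF, chart, chartR, chartS, chartT, hs, pointF]
  ext <;> simp only <;> ring

theorem ptF_fst_bound : |ptF.1 - 2.73| < 0.005 := by
  obtain ⟨h1, h2⟩ := curveRT_half_bounds
  rw [ptF_eq, abs_lt]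
  constructor <;> simp only <;> nlinarith

theorem ptF_snd_bound : |ptF.2 - 0.72| < 0.005 := by
  obtain ⟨h1, h2⟩ := curveRT_half_bounds
  rw [ptF_eq, abs_lt]
  constructor <;> simp only <;> nlinarith

theorem image_diff_pair {S T : Set (ℝ × ℝ)} (hS : S ⊆ closedSquare) {a b : ℝ × ℝ}
    (ha : a ∈ closedSquare) (hb : b ∈ closedSquare) (ha1 : a.2 < 1) (hb1 : b.2 < 1)
    (hT : S \ {a, b} = T) : chart '' S \ {chart a, chart b} = chart '' T := by
  rw [← hT, ← Set.image_pair, image_chart_diff hS]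
  · rintro x (rfl | rfl)
    exacts [ha, hb]
  · rintro x (rfl | rfl)
    exacts [ha1, hb1]

theorem ptO_mem : ((0 : ℝ), (0 : ℝ)) ∈ closedSquare := by norm_num [closedSquare]
theorem ptA_mem : ((1 : ℝ), (0 : ℝ)) ∈ closedSquare := by norm_num [closedSquare]
theorem ptD_mem : ((0 : ℝ), (3 / 5 : ℝ)) ∈ closedSquare := by norm_num [closedSquare]
theorem ptE_mem : ((1 : ℝ), (3 / 5 : ℝ)) ∈ closedSquare := by norm_num [closedSquare]

theorem graphArc_diff (f : ℝ → ℝ) (a b : ℝ) :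
    graphArc f a b \ {(a, f a), (b, f b)} = {x | a < x.1 ∧ x.1 < b ∧ x.2 = f x.1} := by
  ext ⟨l, w⟩
  simp only [graphArc, Set.mem_sdiff, Set.mem_insert_iff, Set.mem_singleton_iff, Prod.mk.injEq,
    Set.mem_ofPred_eq]
  constructor
  · rintro ⟨⟨h1, h2, rfl⟩, hn⟩
    refine ⟨lt_of_le_of_ne h1 ?_, lt_of_le_of_ne h2 ?_, rfl⟩
    · rintro rfl; simp at hn
    · rintro rfl; simp at hn
  · rintro ⟨h1, h2, h3⟩
    refine ⟨⟨h1.le, h2.le, h3⟩, ?_⟩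
    rintro (⟨h, -⟩ | ⟨h, -⟩)
    · exact h1.ne' h
    · exact h2.ne h

theorem graphArc_union_half (f : ℝ → ℝ) :
    graphArc f 0 (1 / 2) ∪ graphArc f (1 / 2) 1 = graphArc f 0 1 := by
  ext ⟨l, w⟩
  simp only [graphArc, Set.mem_union, Set.mem_ofPred_eq]
  constructor
  · rintro (⟨h1, h2, h3⟩ | ⟨h1, h2, h3⟩)
    · exact ⟨h1, by linarith, h3⟩
    · exact ⟨by linarith, h2, h3⟩
  · rintro ⟨h1, h2, h3⟩
    rcases le_total l (1 / 2) with h | h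
    · exact Or.inl ⟨h1, h, h3⟩
    · exact Or.inr ⟨h, h2, h3⟩

theorem arcAF_union_arcFD : arcAF ∪ arcFD = graphArc curveRT 0 1 := by
  rw [Set.union_comm]; exact graphArc_union_half curveRT

theorem arcOF_union_arcFE : arcOF ∪ arcFE = graphArc curveS 0 1 := graphArc_union_half curveS

theorem curve_g_eq : {u ∈ region | g u = 0} =
    (chart '' arcAF ∪ chart '' arcFD) \ {ptA, ptD} := by
  have hS := Set.union_subset isLow_AF.1 isLow_FD.1
  rw [arcAF_union_arcFD] at hS
  have hd := graphArc_diff curveRT 0 1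
  rw [curveRT_zero, curveRT_one] at hd
  rw [← Set.image_union, arcAF_union_arcFD, ← chart_ptA, ← chart_ptD, Set.pair_comm,
    image_diff_pair hS ptD_mem ptA_mem (by norm_num) (by norm_num) hd]
  refine region_inter_eq_image ?_ fun x hx => ?_
  · rintro x ⟨h1, h2, h3⟩
    exact ⟨h1, h2, h3 ▸ curveRT_pos h1.le h2, h3 ▸ curveRT_lt_one h1.le h2.le⟩
  · rw [g_chart_eq_zero_iff hx]
    exact ⟨fun h => ⟨hx.1, hx.2.1, h⟩, fun h => h.2.2⟩

theorem curve_h_eq : {u ∈ region | h u = 0} =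
    (chart '' arcOF ∪ chart '' arcFE ∪ chart '' arcED) \ {ptO, ptE, ptD} := by
  have hS := Set.union_subset isLow_OF.1 isLow_FE.1
  rw [arcOF_union_arcFE] at hS
  have hpts : ({ptO, ptE, ptD} : Set (ℝ × ℝ)) =
      chart '' {((0 : ℝ), (0 : ℝ)), ((1 : ℝ), (3 / 5 : ℝ)), ((0 : ℝ), (3 / 5 : ℝ))} := by
    rw [Set.image_insert_eq, Set.image_pair, chart_ptO, chart_ptE, chart_ptD]
  rw [← Set.image_union, ← Set.image_union, arcOF_union_arcFE, hpts, image_chart_diff]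
  · have hmem (x : ℝ × ℝ) : x ∈ (graphArc curveS 0 1 ∪ arcED) \
        {((0 : ℝ), (0 : ℝ)), ((1 : ℝ), (3 / 5 : ℝ)), ((0 : ℝ), (3 / 5 : ℝ))} ↔
        0 < x.1 ∧ x.1 < 1 ∧ (x.2 = curveR x.1 ∨ x.2 = curveS x.1) := by
      obtain ⟨l, w⟩ := x
      simp only [graphArc, arcED, Set.mem_sdiff, Set.mem_union, Set.mem_insert_iff,
        Set.mem_singleton_iff, Prod.mk.injEq, Set.mem_ofPred_eq]
      constructor
      · rintro ⟨h1, hn⟩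
        have h0 : 0 ≤ l := by rcases h1 with h1 | h1 <;> exact h1.1
        have h2 : l ≤ 1 := by rcases h1 with h1 | h1 <;> exact h1.2.1
        refine ⟨lt_of_le_of_ne h0 ?_, lt_of_le_of_ne h2 ?_, ?_⟩
        · rintro rfl
          rw [curveS_zero, curveR_zero] at h1
          tauto
        · rintro rfl
          rw [curveS_one, curveR_one] at h1
          tauto
        · tauto
      · rintro ⟨h1, h2, h3⟩
        refine ⟨?_, ?_⟩
        · rcases h3 with h3 | h3
          · exact Or.inr ⟨h1.le, h2.le, h3⟩
          · exact Or.inl ⟨h1.le, h2.le, h3⟩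
        · rintro (⟨h, -⟩ | ⟨h, -⟩ | ⟨h, -⟩)
          · exact h1.ne' h
          · exact h2.ne h
          · exact h1.ne' h
    refine region_inter_eq_image ?_ fun x hx => ?_
    · intro x hx
      obtain ⟨h1, h2, h3 | h3⟩ := (hmem x).1 hx
      · refine ⟨h1, h2, ?_, h3 ▸ curveR_lt_one⟩
        exact h3 ▸ (curveRT_nonneg h1.le h2.le).trans_lt (curveRT_lt_curveR h1 h2.le)
      · exact ⟨h1, h2, h3 ▸ curveS_pos h1 h2.le, h3 ▸ curveS_lt_one h1.le h2.le⟩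
    · rw [h_chart_eq_zero_iff hx, hmem]
      exact ⟨fun h => ⟨hx.1, hx.2.1, h⟩, fun h => h.2.2⟩
  · exact Set.union_subset hS isLow_ED.1
  · rintro x (rfl | rfl | rfl)
    exacts [ptO_mem, ptE_mem, ptD_mem]
  · rintro x (rfl | rfl | rfl) <;> norm_num

theorem curveRT_lt_curveS_iff {l : ℝ} (h0 : 0 ≤ l) (h1 : l ≤ 1) :
    curveRT l < curveS l ↔ 1 / 2 < l :=
  ⟨fun h => not_le.1 fun hl => h.not_ge (curveS_le_curveRT h0 hl),
    fun h => curveRT_lt_curveS h h1⟩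

theorem curveS_lt_curveRT_iff {l : ℝ} (h0 : 0 ≤ l) (h1 : l ≤ 1) :
    curveS l < curveRT l ↔ l < 1 / 2 :=
  ⟨fun h => not_le.1 fun hl => h.not_ge (curveRT_le_curveS hl h1),
    fun h => curveS_lt_curveRT h0 h⟩

theorem image_cellOAF : chart '' cellOAF =
    {u ∈ region | IsMorse (p u) ∧ passport (p u) = [4, 2, 3, 1]} := by
  refine (region_inter_eq_image isCell_OAF.cell_subset fun x hx => ?_).symm
  rw [passport_4231_iff hx, ← lt_min_iff]
  exact ⟨fun h => ⟨hx.1, hx.2.1, hx.2.2.1, h⟩, fun h => h.2.2.2⟩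

theorem image_cellAEF : chart '' cellAEF =
    {u ∈ region | IsMorse (p u) ∧ passport (p u) = [3, 2, 4, 1]} := by
  refine (region_inter_eq_image isCell_AEF.cell_subset fun x hx => ?_).symm
  rw [passport_3241_iff hx]
  exact ⟨fun h => ⟨(curveRT_lt_curveS_iff hx.1.le hx.2.1.le).1 (h.2.trans h.1), hx.2.1, h.2, h.1⟩,
    fun h => ⟨h.2.2.2, h.2.2.1⟩⟩

theorem image_cellODF : chart '' cellODF =
    {u ∈ region | IsMorse (p u) ∧ passport (p u) = [4, 1, 3, 2]} := by
  refine (region_inter_eq_image isCell_ODF.cell_subset fun x hx => ?_).symm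
  rw [passport_4132_iff hx]
  exact ⟨fun h => ⟨hx.1, (curveS_lt_curveRT_iff hx.1.le hx.2.1.le).1 (h.1.trans h.2), h.1, h.2⟩,
    fun h => h.2.2⟩

theorem image_cellDEF : chart '' cellDEF =
    {u ∈ region | IsMorse (p u) ∧ passport (p u) = [3, 1, 4, 2]} := by
  refine (region_inter_eq_image isCell_DEF.cell_subset fun x hx => ?_).symm
  rw [passport_3142_iff hx, ← and_assoc, ← max_lt_iff]
  exact ⟨fun h => ⟨hx.1, hx.2.1, h⟩, fun h => h.2.2⟩

theorem image_cellBDE : chart '' cellBDE =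
    {u ∈ region | IsMorse (p u) ∧ passport (p u) = [2, 1, 4, 3]} := by
  refine (region_inter_eq_image isCell_BDE.cell_subset fun x hx => ?_).symm
  rw [passport_2143_iff hx]
  exact ⟨fun h => ⟨hx.1, hx.2.1, h, hx.2.2.2⟩, fun h => h.2.2.1⟩

theorem image_AF_diff : chart '' arcAF \ {ptA, ptF} =
    {u ∈ region | IsDegenerateSnake (p u) ∧ passport (p u) = [3, 2, 3, 1]} := by
  have hd := graphArc_diff curveRT (1 / 2) 1
  rw [curveRT_one] at hd
  rw [Set.pair_comm, ptF, ← chart_ptA, image_diff_pair isLow_AF.1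
    (openSquare_subset pointF_mem) ptA_mem pointF_mem.2.2.2 (by norm_num) hd]
  refine (region_inter_eq_image ?_ fun x hx => ?_).symm
  · rintro x ⟨h1, h2, h3⟩
    have h0 : 0 < x.1 := by linarith
    exact ⟨h0, h2, h3 ▸ curveRT_pos h0.le h2, h3 ▸ curveRT_lt_one h0.le h2.le⟩
  · rw [passport_3231_iff hx]
    constructor
    · rintro ⟨h1, h2⟩
      exact ⟨(curveRT_lt_curveS_iff hx.1.le hx.2.1.le).1 (h2 ▸ h1), hx.2.1, h2⟩
    · rintro ⟨h1, h2, h3⟩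
      exact ⟨h3 ▸ curveRT_lt_curveS h1 h2.le, h3⟩

theorem image_OF_diff : chart '' arcOF \ {ptO, ptF} =
    {u ∈ region | IsDegenerateSnake (p u) ∧ passport (p u) = [3, 1, 2, 1]} := by
  have hd := graphArc_diff curveS 0 (1 / 2)
  rw [curveS_zero, curveS_half] at hd
  rw [ptF, ← chart_ptO, image_diff_pair isLow_OF.1 ptO_mem
    (openSquare_subset pointF_mem) (by norm_num) pointF_mem.2.2.2 hd]
  refine (region_inter_eq_image ?_ fun x hx => ?_).symm
  · rintro x ⟨h1, h2, h3⟩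
    have h4 : x.1 < 1 := by linarith
    exact ⟨h1, h4, h3 ▸ curveS_pos h1 h4.le, h3 ▸ curveS_lt_one h1.le h4.le⟩
  · rw [passport_3121_iff hx]
    constructor
    · rintro ⟨h1, h2⟩
      exact ⟨hx.1, (curveS_lt_curveRT_iff hx.1.le hx.2.1.le).1 (h1 ▸ h2), h1⟩
    · rintro ⟨h1, h2, h3⟩
      exact ⟨h3, h3 ▸ curveS_lt_curveRT h1.le h2⟩

theorem image_FD_diff : chart '' arcFD \ {ptF, ptD} =
    {u ∈ region | IsDegenerateSnake (p u) ∧ passport (p u) = [3, 1, 3, 2]} := by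
  have hd := graphArc_diff curveRT 0 (1 / 2)
  rw [curveRT_zero] at hd
  rw [Set.pair_comm, ptF, ← chart_ptD, image_diff_pair isLow_FD.1 ptD_mem
    (openSquare_subset pointF_mem) (by norm_num) pointF_mem.2.2.2 hd]
  refine (region_inter_eq_image ?_ fun x hx => ?_).symm
  · rintro x ⟨h1, h2, h3⟩
    have h4 : x.1 < 1 := by linarith
    exact ⟨h1, h4, h3 ▸ curveRT_pos h1.le h4, h3 ▸ curveRT_lt_one h1.le h4.le⟩
  · rw [passport_3132_iff hx]
    constructor
    · rintro ⟨h1, h2⟩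
      exact ⟨hx.1, (curveS_lt_curveRT_iff hx.1.le hx.2.1.le).1 (h2 ▸ h1), h2⟩
    · rintro ⟨h1, h2, h3⟩
      exact ⟨h3 ▸ curveS_lt_curveRT h1.le h2, h3⟩

theorem image_FE_diff : chart '' arcFE \ {ptF, ptE} =
    {u ∈ region | IsDegenerateSnake (p u) ∧ passport (p u) = [2, 1, 3, 1]} := by
  have hd := graphArc_diff curveS (1 / 2) 1
  rw [curveS_one, curveS_half] at hd
  rw [ptF, ← chart_ptE, image_diff_pair isLow_FE.1 (openSquare_subset pointF_mem)
    ptE_mem pointF_mem.2.2.2 (by norm_num) hd]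
  refine (region_inter_eq_image ?_ fun x hx => ?_).symm
  · rintro x ⟨h1, h2, h3⟩
    have h0 : 0 < x.1 := by linarith
    exact ⟨h0, h2, h3 ▸ curveS_pos h0 h2.le, h3 ▸ curveS_lt_one h0.le h2.le⟩
  · rw [passport_2131_iff hx]
    constructor
    · rintro ⟨h1, h2⟩
      exact ⟨(curveRT_lt_curveS_iff hx.1.le hx.2.1.le).1 (h1 ▸ h2), hx.2.1, h1⟩
    · rintro ⟨h1, h2, h3⟩
      exact ⟨h3, h3 ▸ curveRT_lt_curveS h1 h2.le⟩

theorem image_ED_diff : chart '' arcED \ {ptE, ptD} =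
    {u ∈ region | IsDegenerateSnake (p u) ∧ passport (p u) = [2, 1, 3, 2]} := by
  have hd := graphArc_diff curveR 0 1
  rw [curveR_zero, curveR_one] at hd
  rw [Set.pair_comm, ← chart_ptE, ← chart_ptD, image_diff_pair isLow_ED.1 ptD_mem ptE_mem
    (by norm_num) (by norm_num) hd]
  refine (region_inter_eq_image ?_ fun x hx => ?_).symm
  · rintro x ⟨h1, h2, h3⟩
    refine ⟨h1, h2, ?_, h3 ▸ curveR_lt_one⟩
    exact h3 ▸ (curveRT_nonneg h1.le h2.le).trans_lt (curveRT_lt_curveR h1 h2.le)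
  · rw [passport_2132_iff hx]
    exact ⟨fun h => ⟨hx.1, hx.2.1, h⟩, fun h => h.2.2⟩

/-- By injectivity the point at parameter 1/2 differs from both endpoints. This supplies an example
of each degenerate passport. -/
theorem IsSimpleArc.nonempty_diff {γ : Set (ℝ × ℝ)} {Y Z : ℝ × ℝ} (hγ : IsSimpleArc γ Y Z) :
    (γ \ {Y, Z}).Nonempty := by
  obtain ⟨f, hf, rfl⟩ := hγ
  have hm : (1 / 2 : ℝ) ∈ unitInterval := ⟨by norm_num, by norm_num⟩
  refine ⟨f ⟨1 / 2, hm⟩, ⟨_, rfl⟩, ?_⟩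
  rintro (h | h)
  · have := congrArg Subtype.val (hf (h.trans f.source.symm))
    norm_num at this
  · have := congrArg Subtype.val (hf (Eq.trans h f.target.symm))
    norm_num at this

/-! ### Passports of quintics -/

theorem complement_of_curves_eq : {u ∈ region | g u ≠ 0 ∧ h u ≠ 0} =
    chart '' cellOAF ∪ chart '' cellAEF ∪ chart '' cellODF ∪ chart '' cellDEF ∪
      chart '' cellBDE := by
  rw [image_cellOAF, image_cellAEF, image_cellODF, image_cellDEF, image_cellBDE]
  ext u
  constructor
  · rintro ⟨hu, hgh⟩
    have hM := (isMorse_p_iff_of_mem_region hu).2 hgh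
    have hu' := hu
    rw [region_eq_image] at hu'
    obtain ⟨x, hx, rfl⟩ := hu'
    rcases passport_of_isMorse hx hM with h | h | h | h | h
    · exact Or.inl (Or.inl (Or.inl (Or.inl ⟨hu, hM, h⟩)))
    · exact Or.inl (Or.inl (Or.inl (Or.inr ⟨hu, hM, h⟩)))
    · exact Or.inl (Or.inl (Or.inr ⟨hu, hM, h⟩))
    · exact Or.inl (Or.inr ⟨hu, hM, h⟩)
    · exact Or.inr ⟨hu, hM, h⟩
  · rintro ((((⟨hu, hM, -⟩ | ⟨hu, hM, -⟩) | ⟨hu, hM, -⟩) | ⟨hu, hM, -⟩) | ⟨hu, hM, -⟩) <;>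
      exact ⟨hu, (isMorse_p_iff_of_mem_region hu).1 hM⟩

/-- Each cell is the locus of one passport, and the five passports are distinct. -/
theorem pairwise_disjoint_cells : [chart '' cellOAF, chart '' cellAEF, chart '' cellODF,
    chart '' cellDEF, chart '' cellBDE].Pairwise Disjoint := by
  rw [image_cellOAF, image_cellAEF, image_cellODF, image_cellDEF, image_cellBDE]
  have key (a b : List ℕ) (hab : a ≠ b) :
      Disjoint {u ∈ region | IsMorse (p u) ∧ passport (p u) = a}
        {u ∈ region | IsMorse (p u) ∧ passport (p u) = b} :=
    Set.disjoint_left.2 fun u h h' => hab (h.2.2.symm.trans h'.2.2)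
  exact (show [[4, 2, 3, 1], [3, 2, 4, 1], [4, 1, 3, 2], [3, 1, 4, 2], [2, 1, 4, 3]].Pairwise
    (fun a b : List ℕ => a ≠ b) by decide).map
      (fun a => {u ∈ region | IsMorse (p u) ∧ passport (p u) = a}) key

/-- Normalisation reduces an arbitrary Morse quintic to some `p u` with u in `region`, where
`passport_of_isMorse` applies. Conversely each cell is connected, in particular nonempty, and any of
its points realises the passport. -/
theorem morse_passports_eq :
    {a | ∃ P : ℝ[X], P.natDegree = 5 ∧ IsMorse P ∧ passport P = a} =
      {[4, 2, 3, 1], [3, 2, 4, 1], [4, 1, 3, 2], [3, 1, 4, 2], [2, 1, 4, 3]} := by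
  ext a
  constructor
  · rintro ⟨P, h5, hM, rfl⟩
    obtain ⟨u, hu, -, -, -, -, -, -, hp, hM'⟩ :=
      exists_normalization hM.1 h5 (card_criticalPoints_of_isMorse h5 hM)
    rw [region_eq_image] at hu
    obtain ⟨x, hx, rfl⟩ := hu
    exact hp ▸ passport_of_isMorse hx (hM'.2 hM)
  · have key {T : Set (ℝ × ℝ)} {b : List ℕ} (hT : IsConnected T)
        (h : T = {u ∈ region | IsMorse (p u) ∧ passport (p u) = b}) :
        ∃ P : ℝ[X], P.natDegree = 5 ∧ IsMorse P ∧ passport P = b := by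
      obtain ⟨u, hu⟩ := hT.nonempty
      rw [h] at hu
      exact ⟨p u, natDegree_p u, hu.2⟩
    rintro (rfl | rfl | rfl | rfl | rfl)
    · exact key isCell_OAF.isConnected_image image_cellOAF
    · exact key isCell_AEF.isConnected_image image_cellAEF
    · exact key isCell_ODF.isConnected_image image_cellODF
    · exact key isCell_DEF.isConnected_image image_cellDEF
    · exact key isCell_BDE.isConnected_image image_cellBDE

theorem degenerate_passports_eq :
    {a | ∃ P : ℝ[X], IsDegenerateSnake P ∧ passport P = a} =
      {[3, 1, 3, 2], [3, 2, 3, 1], [3, 1, 2, 1], [2, 1, 3, 1], [2, 1, 3, 2]} := by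
  ext a
  constructor
  · rintro ⟨P, ⟨hP, h5, hc, hv⟩, rfl⟩
    obtain ⟨u, hu, -, -, -, -, -, hv', hp, -⟩ := exists_normalization hP h5 hc
    obtain ⟨r, s, t, hrs, hst, ht, hr⟩ := mem_region_iff.1 hu
    have hD : IsDegenerateSnake (p u) := by
      rw [isDegenerateSnake_p_iff hrs hst ht hr, ← criticalValues_p_eq hr, hv', hv]
    rw [region_eq_image] at hu
    obtain ⟨x, hx, rfl⟩ := hu
    exact hp ▸ passport_of_isDegenerateSnake hx hD
  · have key {γ : Set (ℝ × ℝ)} {Y Z : ℝ × ℝ} {b : List ℕ} (hγ : IsSimpleArc γ Y Z)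
        (h : γ \ {Y, Z} = {u ∈ region | IsDegenerateSnake (p u) ∧ passport (p u) = b}) :
        ∃ P : ℝ[X], IsDegenerateSnake P ∧ passport P = b := by
      obtain ⟨u, hu⟩ := hγ.nonempty_diff
      rw [h] at hu
      exact ⟨p u, hu.2⟩
    rintro (rfl | rfl | rfl | rfl | rfl)
    · exact key isSimpleArc_FD image_FD_diff
    · exact key isSimpleArc_AF image_AF_diff
    · exact key isSimpleArc_OF image_OF_diff
    · exact key isSimpleArc_FE image_FE_diff
    · exact key isSimpleArc_ED image_ED_diff

end MorseQuintic

/-! ### The partition of the parameter triangle by snakes of order 4 -/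

open Polynomial MorseQuintic in
theorem mainTheorem1 :
    -- normalisation of a real Morse polynomial of degree 5
    (∀ P : ℝ[X], P.natDegree = 5 → IsMorse P →
      ∃ u ∈ region, ∃ k l m : ℝ, 0 < k ∧
        P.comp (C k * X + C l) = C (k ^ 5) * p u + C m ∧
        IsMorse (p u) ∧ passport (p u) = passport P) ∧
    (∀ u : ℝ × ℝ, derivative (p u) = C 5 * (X * q u)) ∧
    -- the discriminant curve and the region it cuts out
    (∀ u : ℝ × ℝ, (q u).discr = dq u) ∧
    region = {u | 0 < u.1 ∧ 0 < u.2 ∧ 0 < dq u} ∧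
    -- the meaning of the curves `g = 0` and `h = 0`
    (∀ u ∈ region, g u = 0 ↔
      ∃ x y : ℝ, x ≠ y ∧ (q u).IsRoot x ∧ (q u).IsRoot y ∧ (p u).eval x = (p u).eval y) ∧
    (∀ u ∈ region, h u = 0 ↔ ∃ x : ℝ, (q u).IsRoot x ∧ (p u).eval x = 0) ∧
    (∀ u : ℝ × ℝ, 0 < u.1 → 0 < u.2 → (IsMorse (p u) ↔ u ∈ region ∧ g u ≠ 0 ∧ h u ≠ 0)) ∧
    -- the partition
    (∃ (F : ℝ × ℝ) (OA AE EB AF FD OF FE ED OAF AEF ODF DEF BDE : Set (ℝ × ℝ)),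
      -- the point `F`
      {u ∈ region | g u = 0 ∧ h u = 0} = {F} ∧
      |F.1 - 2.73| < 0.005 ∧ |F.2 - 0.72| < 0.005 ∧
      -- the triangle `OAB`, with sides on `dq = 0` and on the axis `c = 0`
      IsCurvilinearTriangle region ptO ptA ptB OA (AE ∪ EB) (segment ℝ ptB ptO) ∧
      {u | 0 ≤ u.1 ∧ 0 ≤ u.2 ∧ dq u = 0} = OA ∪ AE ∪ EB ∧
      -- the arcs cut out in it by `g = 0` and `h = 0`
      {u ∈ region | g u = 0} = (AF ∪ FD) \ {ptA, ptD} ∧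
      {u ∈ region | h u = 0} = (OF ∪ FE ∪ ED) \ {ptO, ptE, ptD} ∧
      -- the five triangles
      IsCurvilinearTriangle OAF ptO ptA F OA AF OF ∧
      IsCurvilinearTriangle AEF ptA ptE F AE FE AF ∧
      IsCurvilinearTriangle ODF ptO ptD F (segment ℝ ptO ptD) FD OF ∧
      IsCurvilinearTriangle DEF ptD ptE F ED FE FD ∧
      IsCurvilinearTriangle BDE ptB ptD ptE (segment ℝ ptB ptD) ED EB ∧
      [OAF, AEF, ODF, DEF, BDE].Pairwise Disjoint ∧
      {u ∈ region | g u ≠ 0 ∧ h u ≠ 0} = OAF ∪ AEF ∪ ODF ∪ DEF ∪ BDE ∧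
      -- the snakes of the five triangles
      OAF = {u ∈ region | IsMorse (p u) ∧ passport (p u) = [4, 2, 3, 1]} ∧
      AEF = {u ∈ region | IsMorse (p u) ∧ passport (p u) = [3, 2, 4, 1]} ∧
      ODF = {u ∈ region | IsMorse (p u) ∧ passport (p u) = [4, 1, 3, 2]} ∧
      DEF = {u ∈ region | IsMorse (p u) ∧ passport (p u) = [3, 1, 4, 2]} ∧
      BDE = {u ∈ region | IsMorse (p u) ∧ passport (p u) = [2, 1, 4, 3]} ∧
      -- the degenerate snakes of the five separating arcs
      AF \ {ptA, F} = {u ∈ region | IsDegenerateSnake (p u) ∧ passport (p u) = [3, 2, 3, 1]} ∧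
      OF \ {ptO, F} = {u ∈ region | IsDegenerateSnake (p u) ∧ passport (p u) = [3, 1, 2, 1]} ∧
      FD \ {F, ptD} = {u ∈ region | IsDegenerateSnake (p u) ∧ passport (p u) = [3, 1, 3, 2]} ∧
      FE \ {F, ptE} = {u ∈ region | IsDegenerateSnake (p u) ∧ passport (p u) = [2, 1, 3, 1]} ∧
      ED \ {ptE, ptD} =
        {u ∈ region | IsDegenerateSnake (p u) ∧ passport (p u) = [2, 1, 3, 2]}) ∧
    -- these are all the snakes and all the degenerate snakes of order 4
    {a | ∃ P : ℝ[X], P.natDegree = 5 ∧ IsMorse P ∧ passport P = a} =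
      {[4, 2, 3, 1], [3, 2, 4, 1], [4, 1, 3, 2], [3, 1, 4, 2], [2, 1, 4, 3]} ∧
    {a | ∃ P : ℝ[X], IsDegenerateSnake P ∧ passport P = a} =
      {[3, 1, 3, 2], [3, 2, 3, 1], [3, 1, 2, 1], [2, 1, 3, 1], [2, 1, 3, 2]} := by
  refine ⟨fun P h5 hM => ?_, derivative_p, discr_q, region_eq, fun u hu => g_eq_zero_iff hu,
    fun u hu => h_eq_zero_iff hu, fun u hb hc => isMorse_p_iff_of_pos hb hc, ?_,
    morse_passports_eq, degenerate_passports_eq⟩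
  · obtain ⟨u, hu, k, l, m, hk, hP, -, hp, hM'⟩ :=
      exists_normalization hM.1 h5 (card_criticalPoints_of_isMorse h5 hM)
    exact ⟨u, hu, k, l, m, hk, hP, hM'.2 hM, hp⟩
  · refine ⟨ptF, chart '' arcOA, chart '' arcAE, chart '' arcEB, chart '' arcAF, chart '' arcFD,
      chart '' arcOF, chart '' arcFE, chart '' arcED, chart '' cellOAF, chart '' cellAEF,
      chart '' cellODF, chart '' cellDEF, chart '' cellBDE, intersection_eq, ptF_fst_bound,
      ptF_snd_bound, ?_, ?_, curve_g_eq, curve_h_eq, triangle_OAF, triangle_AEF, ?_,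
      triangle_DEF, ?_, pairwise_disjoint_cells, complement_of_curves_eq, image_cellOAF,
      image_cellAEF, image_cellODF, image_cellDEF, image_cellBDE, image_AF_diff, image_OF_diff,
      image_FD_diff, image_FE_diff, image_ED_diff⟩
    · rw [image_AE_union_EB, ← image_OB]
      exact triangle_OAB
    · rw [Set.union_assoc, image_AE_union_EB]
      exact discriminant_curve_eq
    · rw [← image_OD]
      exact triangle_ODF
    · rw [← image_DB]
      exact triangle_BDE
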